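/- Let $X$ be a noetherian scheme satisfying Serre's condition $S_2$, and let $\mathcal K_X$ be its sheaf of total quotient rings. An $\mathcal O_X$-module $\mathcal F$ satisfies $S_2$ if $\operatorname{depth}\mathcal F_x\ge\min(2,\dim\mathcal O_{X,x})$ for all $x\in X$. A generalized divisor $D$ on $X$ is a coherent $\mathcal O_X$-submodule $\mathcal I\subseteq\mathcal K_X$ (the ideal of $D$) that satisfies $S_2$ and has $\mathcal I_\eta=\mathcal K_{X,\eta}$ at every generic point $\eta$ of $X$. It is principal if $\mathcal I=(f)=\mathcal O_X\cdot f$ for some global section $f$ of $\mathcal K_X$. For a subsheaf $\mathcal I\subseteq\mathcal K_X$ let $\mathcal I^{\sim}$ be its $S_2$-ification, i.e. the sheaf of those sections of $\mathcal K_X$ whose germ at every point $x$ with $\dim\mathcal O_{X,x}\le 1$ lies in $\mathcal I_x$. The sum of divisors with ideals $\mathcal I_1,\mathcal I_2$ is given by $(\mathcal I_1\cdot\mathcal I_2)^{\sim}$, and two divisors are linearly equivalent if one is obtained from the other by adding a principal divisor. Proposition 2.4. (1) Two generalized divisors $D_1,D_2$ on $X$ are linearly equivalent if and only if their ideals $\mathcal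 I_1,\mathcal I_2$ are isomorphic as $\mathcal O_X$-modules. (2) Every coherent $\mathcal O_X$-module that satisfies $S_2$ and is locally free of rank $1$ at every generic point of $X$ is isomorphic to the ideal of some generalized divisor on $X$. -/

import Mathlib

open CategoryTheory AlgebraicGeometry TopologicalSpace

universe u

noncomputable section

namespace GenDiv

/-! ### Depth and Serre's conditions -/

section Depth

variable (A : Type*) [CommRing A] [IsLocalRing A] (M : Type*) [AddCommGroup M] [Module A M]

/-- The depth of a finitely generated module `M` over a noetherian local ring `A`: the supremum of
the lengths of the `M`-regular sequences contained in the maximal ideal. (For `M ≠ 0` finitely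
generated, weakly regular and regular are the same for sequences in the maximal ideal; with weakly
regular sequences the zero module gets depth `⊤`.) -/
def depth : ℕ∞ :=
  ⨆ (rs : List A) (_ : (∀ r ∈ rs, r ∈ IsLocalRing.maximalIdeal A) ∧
    RingTheory.Sequence.IsWeaklyRegular M rs), (rs.length : ℕ∞)

end Depth

/-- The stalk of an `𝒪_X`-module at a point, as a module over the local ring of `X`. -/
instance stalkModule {X : Scheme.{u}} (F : X.Modules) (x : X) :
    Module (X.presheaf.stalk x) (F.presheaf.stalk x) :=
  let M : PresheafOfModules.{u} (X.presheaf ⋙ forget₂ CommRingCat RingCat) := F.val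
  inferInstanceAs (Module (X.presheaf.stalk x) ↑(TopCat.Presheaf.stalk M.presheaf x))

/-- Serre's condition `S_n` for an `𝒪_X`-module: `depth F_x ≥ min (n, dim 𝒪_{X,x})` for every
point `x`. -/
def SatisfiesSerre {X : Scheme.{u}} (n : ℕ) (F : X.Modules) : Prop :=
  ∀ x : X, min (n : WithBot ℕ∞) (ringKrullDim (X.presheaf.stalk x)) ≤
    (depth (X.presheaf.stalk x) (F.presheaf.stalk x) : WithBot ℕ∞)

/-- Serre's condition `S_n` for a scheme: `depth 𝒪_{X,x} ≥ min (n, dim 𝒪_{X,x})` for every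
point `x`. -/
def SchemeSatisfiesSerre (n : ℕ) (X : Scheme.{u}) : Prop :=
  ∀ x : X, min (n : WithBot ℕ∞) (ringKrullDim (X.presheaf.stalk x)) ≤
    (depth (X.presheaf.stalk x) (X.presheaf.stalk x) : WithBot ℕ∞)

/-- Coherence of an `𝒪_X`-module on a (locally) noetherian scheme: quasi-coherent and of finite
type. -/
structure IsCoherent {X : Scheme.{u}} (F : X.Modules) : Prop where
  isQuasicoherent : F.IsQuasicoherent
  isFiniteType : F.IsFiniteType

/-- `F` is locally free of rank one at the point `x`: the stalk `F_x` is isomorphic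
to `𝒪_{X,x}`. -/
def IsLocallyFreeOfRankOneAt {X : Scheme.{u}} (F : X.Modules) (x : X) : Prop :=
  Nonempty (F.presheaf.stalk x ≃ₗ[X.presheaf.stalk x] X.presheaf.stalk x)

/-! ### Subsheaves of the sheaf of families of fractions -/

variable (X : Scheme.{u})

/-- The total ring of fractions of the local ring of `X` at `x`. -/
abbrev TotFrac (x : X) : Type u := FractionRing (X.presheaf.stalk x)

/-- Arbitrary families `(s_x)`, for `x ∈ U`, of elements of the total rings of fractions of the
local rings. This is an algebra over `Γ(X, U)` by taking germs; it is the ambient sheaf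
in which the sheaf of total quotient rings is constructed. -/
abbrev Fam (U : X.Opens) : Type u := ∀ x : U, TotFrac X x.1

variable {X}

/-- Restriction of families to a smaller open set. -/
def Fam.res {U V : X.Opens} (h : V ≤ U) (s : Fam X U) : Fam X V := fun x => s ⟨x.1, h x.2⟩

lemma Fam.smul_apply {U : X.Opens} (r : Γ(X, U)) (s : Fam X U) (x : U) :
    (r • s) x = algebraMap (X.presheaf.stalk x.1) (TotFrac X x.1)
      (X.presheaf.germ U x.1 x.2 r) * s x := by
  rw [Pi.smul_apply, ← algebraMap_smul (X.presheaf.stalk x.1) r (s x), Algebra.smul_def]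
  rfl

lemma Fam.res_smul {U V : X.Opens} (h : V ≤ U) (r : Γ(X, U)) (s : Fam X U) :
    Fam.res h (r • s) = X.presheaf.map (homOfLE h).op r • Fam.res h s := by
  funext x
  simp only [Fam.res, Fam.smul_apply, TopCat.Presheaf.germ_res_apply]

variable (X) in
/-- A subsheaf of `𝒪_X`-modules of the sheaf of families of fractions. -/
@[ext]
structure Subsheaf where
  /-- The module of sections over an open set. -/
  obj (U : X.Opens) : Submodule Γ(X, U) (Fam X U)
  res_mem {U V : X.Opens} (h : V ≤ U) {s : Fam X U} (hs : s ∈ obj U) : Fam.res h s ∈ obj V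
  glue {U : X.Opens} (s : Fam X U)
    (hs : ∀ x ∈ U, ∃ (V : X.Opens) (h : V ≤ U), x ∈ V ∧ Fam.res h s ∈ obj V) : s ∈ obj U

namespace Subsheaf

instance : LE (Subsheaf X) where
  le I J := ∀ U, I.obj U ≤ J.obj U

/-- The underlying presheaf of abelian groups. -/
def abPresheaf (I : Subsheaf X) : TopCat.Presheaf Ab.{u} X where
  obj U := AddCommGrpCat.of (I.obj U.unop)
  map {U V} i := AddCommGrpCat.ofHom
    { toFun := fun s => ⟨Fam.res i.unop.le s.1, I.res_mem i.unop.le s.2⟩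
      map_zero' := rfl
      map_add' := fun _ _ => rfl }

lemma isSheaf_abPresheaf (I : Subsheaf X) : I.abPresheaf.IsSheaf := by
  rw [TopCat.Presheaf.isSheaf_iff_isSheaf_comp (forget AddCommGrpCat)]
  apply TopCat.Presheaf.isSheaf_of_isSheafUniqueGluing_types
  intro ι U sf hsf
  have cpt : ∀ (i j : ι) (x : X) (hi : x ∈ U i) (hj : x ∈ U j),
      (sf i).1 ⟨x, hi⟩ = (sf j).1 ⟨x, hj⟩ := fun i j x hi hj =>
    congrFun (congrArg Subtype.val (hsf i j)) ⟨x, hi, hj⟩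
  have ex : ∀ x : (iSup U : X.Opens), ∃ i, x.1 ∈ U i := fun x => Opens.mem_iSup.mp x.2
  choose k hk using ex
  let s : Fam X (iSup U) := fun x => (sf (k x)).1 ⟨x.1, hk x⟩
  have hs : ∀ i, Fam.res (le_iSup U i) s = (sf i).1 := fun i => by
    funext x
    exact cpt _ _ _ _ _
  refine ⟨⟨s, I.glue s fun x hx => ?_⟩, fun i => Subtype.ext (hs i), fun t ht => ?_⟩
  · refine ⟨U (k ⟨x, hx⟩), le_iSup U _, hk _, ?_⟩
    rw [hs]
    exact (sf _).2
  · refine Subtype.ext (funext fun x => ?_)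
    exact congrFun (congrArg Subtype.val (ht (k x))) ⟨x.1, hk x⟩

/-- A subsheaf as an object of the category of `𝒪_X`-modules. -/
def toModules (I : Subsheaf X) : X.Modules where
  val :=
    letI (U : X.Opensᵒᵖ) : Module (X.ringCatSheaf.obj.obj U) (I.abPresheaf.obj U) :=
      inferInstanceAs (Module Γ(X, U.unop) (I.obj U.unop))
    PresheafOfModules.ofPresheaf I.abPresheaf fun _ _ i r m =>
      Subtype.ext (Fam.res_smul i.unop.le r m.1)
  isSheaf := I.isSheaf_abPresheaf

/-- The stalk at `x`, as a submodule of the total ring of fractions of `𝒪_{X,x}`. -/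
def stalk (I : Subsheaf X) (x : X) : Submodule (X.presheaf.stalk x) (TotFrac X x) where
  carrier := {q | ∃ (U : X.Opens) (hx : x ∈ U) (s : Fam X U), s ∈ I.obj U ∧ s ⟨x, hx⟩ = q}
  zero_mem' := ⟨⊤, trivial, 0, zero_mem _, rfl⟩
  add_mem' := by
    rintro _ _ ⟨U, hU, s, hs, rfl⟩ ⟨V, hV, t, ht, rfl⟩
    exact ⟨U ⊓ V, ⟨hU, hV⟩, Fam.res inf_le_left s + Fam.res inf_le_right t,
      add_mem (I.res_mem _ hs) (I.res_mem _ ht), rfl⟩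
  smul_mem' := by
    rintro c _ ⟨U, hU, s, hs, rfl⟩
    obtain ⟨V, hV, r, rfl⟩ := TopCat.Presheaf.exists_germ_eq X.presheaf c
    refine ⟨U ⊓ V, ⟨hU, hV⟩, X.presheaf.map (homOfLE inf_le_right).op r • Fam.res inf_le_left s,
      Submodule.smul_mem _ _ (I.res_mem _ hs), ?_⟩
    rw [Fam.smul_apply, TopCat.Presheaf.germ_res_apply, Algebra.smul_def]
    rfl

end Subsheaf

/-! ### The sheaf of total quotient rings -/

variable (X) in
/-- The sheaf `𝒦_X` of total quotient rings: the sheaf associated to the presheaf sending `V` to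
the ring of fractions of `Γ(X, V)` whose denominators are the sections that are non-zero-divisors
in every local ring `𝒪_{X,y}`, `y ∈ V`. Its sections over `U` are the families that locally on `U`
are of the form `a / b`. -/
def totalQuotientSheaf : Subsheaf X where
  obj U :=
    { carrier := {s | ∀ x ∈ U, ∃ (V : X.Opens) (h : V ≤ U), x ∈ V ∧ ∃ a b : Γ(X, V), ∀ y : V,
        X.presheaf.germ V y.1 y.2 b ∈ nonZeroDivisors (X.presheaf.stalk y.1) ∧
        algebraMap _ (TotFrac X y.1) (X.presheaf.germ V y.1 y.2 b) * s ⟨y.1, h y.2⟩ =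
          algebraMap _ (TotFrac X y.1) (X.presheaf.germ V y.1 y.2 a)}
      zero_mem' := fun x hx => ⟨U, le_rfl, hx, 0, 1, fun y => by
        simp only [map_one, map_zero, Pi.zero_apply, mul_zero, and_true]
        exact one_mem _⟩
      add_mem' := by
        intro s t hs ht x hx
        obtain ⟨V, hV, hxV, a, b, hab⟩ := hs x hx
        obtain ⟨W, hW, hxW, c, d, hcd⟩ := ht x hx
        let ρ := fun r : Γ(X, V) => X.presheaf.map (homOfLE (inf_le_left : V ⊓ W ≤ V)).op r
        let σ := fun r : Γ(X, W) => X.presheaf.map (homOfLE (inf_le_right : V ⊓ W ≤ W)).op r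
        refine ⟨V ⊓ W, inf_le_left.trans hV, ⟨hxV, hxW⟩,
          ρ a * σ d + σ c * ρ b, ρ b * σ d, fun y => ?_⟩
        obtain ⟨h₁, h₂⟩ := hab ⟨y.1, y.2.1⟩
        obtain ⟨h₃, h₄⟩ := hcd ⟨y.1, y.2.2⟩
        simp only [ρ, σ, map_mul, map_add, TopCat.Presheaf.germ_res_apply, Pi.add_apply]
        refine ⟨mul_mem h₁ h₃, ?_⟩
        rw [← h₂, ← h₄]
        ring
      smul_mem' := by
        intro r s hs x hx
        obtain ⟨V, hV, hxV, a, b, hab⟩ := hs x hx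
        refine ⟨V, hV, hxV, X.presheaf.map (homOfLE hV).op r * a, b, fun y => ?_⟩
        obtain ⟨h₁, h₂⟩ := hab y
        refine ⟨h₁, ?_⟩
        rw [Fam.smul_apply, map_mul, map_mul, TopCat.Presheaf.germ_res_apply, ← h₂]
        ring }
  res_mem := by
    intro U U' hU s hs x hx
    obtain ⟨V, hV, hxV, a, b, hab⟩ := hs x (hU hx)
    refine ⟨V ⊓ U', inf_le_right, ⟨hxV, hx⟩, X.presheaf.map (homOfLE inf_le_left).op a,
      X.presheaf.map (homOfLE inf_le_left).op b, fun y => ?_⟩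
    simp only [TopCat.Presheaf.germ_res_apply]
    exact hab ⟨y.1, y.2.1⟩
  glue := by
    intro U s hs x hx
    obtain ⟨V, hV, hxV, h⟩ := hs x hx
    obtain ⟨W, hW, hxW, a, b, hab⟩ := h x hxV
    exact ⟨W, hW.trans hV, hxW, a, b, hab⟩

/-- The sections of `𝒦_X` whose germ at every point `x` lies in the given submodule `N x`. -/
def sectionsIn (N : ∀ x : X, Submodule (X.presheaf.stalk x) (TotFrac X x)) : Subsheaf X where
  obj U :=
    { carrier := {s | s ∈ (totalQuotientSheaf X).obj U ∧ ∀ x : U, s x ∈ N x.1}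
      zero_mem' := ⟨zero_mem _, fun _ => zero_mem _⟩
      add_mem' := fun hs ht => ⟨add_mem hs.1 ht.1, fun x => add_mem (hs.2 x) (ht.2 x)⟩
      smul_mem' := fun r s hs => ⟨Submodule.smul_mem _ r hs.1, fun x => by
        rw [Fam.smul_apply, ← Algebra.smul_def]
        exact Submodule.smul_mem _ _ (hs.2 x)⟩ }
  res_mem := fun h _ hs => ⟨(totalQuotientSheaf X).res_mem h hs.1, fun x => hs.2 ⟨x.1, h x.2⟩⟩
  glue := fun {U} s hs => by
    refine ⟨(totalQuotientSheaf X).glue s fun x hx => ?_, fun x => ?_⟩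
    · obtain ⟨V, h, hxV, hV⟩ := hs x hx
      exact ⟨V, h, hxV, hV.1⟩
    · obtain ⟨V, h, hxV, hV⟩ := hs x.1 x.2
      exact hV.2 ⟨x.1, hxV⟩

/-! ### Generalized divisors -/

/-- A fractional ideal: a subsheaf of `𝒦_X` that is a coherent sheaf of `𝒪_X`-modules. -/
structure IsFractionalIdeal (I : Subsheaf X) : Prop where
  le : I ≤ totalQuotientSheaf X
  coherent : IsCoherent I.toModules

/-- `I` is nondegenerate: `I_η = 𝒦_{X,η}` at every generic point `η` of an irreducible
component of `X`. -/
def IsNondegenerate (I : Subsheaf X) : Prop :=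
  ∀ η ∈ genericPoints X, I.stalk η = (totalQuotientSheaf X).stalk η

variable (X) in
/-- A generalized divisor, given by its ideal sheaf: a nondegenerate fractional ideal that satisfies
`S_2` as a sheaf of `𝒪_X`-modules. -/
structure GeneralizedDivisor where
  /-- The ideal of the divisor. -/
  ideal : Subsheaf X
  isFractionalIdeal : IsFractionalIdeal ideal
  nondegenerate : IsNondegenerate ideal
  serre : SatisfiesSerre 2 ideal.toModules

/-- The subsheaf `(f) = 𝒪_X · f` of `𝒦_X` generated by a global section `f` of `𝒦_X`. -/
def principalIdeal (f : Fam X ⊤) : Subsheaf X :=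
  sectionsIn fun x => Submodule.span (X.presheaf.stalk x) {f ⟨x, trivial⟩}

/-- The product `I · J` of two subsheaves of `𝒦_X`; its stalks are the products of the stalks. -/
def mulIdeal (I J : Subsheaf X) : Subsheaf X :=
  sectionsIn fun x => I.stalk x * J.stalk x

/-- The `S_2`-ification `I^∼` of a fractional ideal `I`, as a subsheaf of `𝒦_X`: the sections
of `𝒦_X` that lie in `I` at all points of codimension at most one. -/
def s2ification (I : Subsheaf X) : Subsheaf X :=
  sectionsIn fun x =>
    { carrier := {q | ringKrullDim (X.presheaf.stalk x) ≤ 1 → q ∈ I.stalk x}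
      zero_mem' := fun _ => zero_mem _
      add_mem' := fun hp hq h => add_mem (hp h) (hq h)
      smul_mem' := fun c _ hq h => Submodule.smul_mem _ c (hq h) }

namespace GeneralizedDivisor

/-- `D` is principal: its ideal is `(f)` for a global section `f` of `𝒦_X`. -/
def IsPrincipal (D : GeneralizedDivisor X) : Prop :=
  ∃ f ∈ (totalQuotientSheaf X).obj ⊤, D.ideal = principalIdeal f

/-- `E` is the sum `D₁ + D₂`: the ideal of `E` is `(I₁ · I₂)^∼`. -/
def IsSum (D₁ D₂ E : GeneralizedDivisor X) : Prop :=
  E.ideal = s2ification (mulIdeal D₁.ideal D₂.ideal)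

/-- Linear equivalence: one of the divisors is obtained from the other by adding a principal
divisor. -/
def LinearlyEquivalent (D₁ D₂ : GeneralizedDivisor X) : Prop :=
  ∃ P : GeneralizedDivisor X, P.IsPrincipal ∧ (D₁.IsSum P D₂ ∨ D₂.IsSum P D₁)

end GeneralizedDivisor

end GenDiv
end

/-! The engine is an induction on codimension (`ideal_eq_top_of_generization`). Attach to each point
an ideal `J x` of the local ring such that a unit ideal at a generization `y` is witnessed in `J x`
by an element invertible at `y`. In the inductive step no prime but the maximal one can then contain
`J x`, and only the case of radical containing the maximal ideal is left, which depth settles. For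
annihilators of a section, depth at least 1 suffices: sections of an `S_2` sheaf are determined by
their germs at the generic points. For the conductor of a section of `𝒦_X` into an ideal `I`, depth
at least 2 does it: an `S_2` ideal equals its `S_2`-ification.

Applied to `𝒪_X`, the first case shows that a section which is a unit at the generic points is a
non-zero-divisor everywhere. Since there are finitely many generic points, a section of `𝒦_X`
amounts to an arbitrary choice of values at them (`exists_section_of_genericPoints`).

For (1), an isomorphism between nondegenerate ideals is multiplication by a constant at each generic
point; these constants form an invertible global section `f` of `𝒦_X`. Conversely a principal
divisor has an invertible generator by nondegeneracy, and adding it to `D` gives exactly `f · I_D`,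
because `I_D` is already `S_2`-saturated. For (2), trivializations of `F` at the generic points
define a map from `F` to `𝒦_X`, injective because sections of `F` are determined generically; its
image is the ideal sought. -/

noncomputable section

namespace GenDiv

/-! ### Induction on codimension along generizations. -/

section Generization

variable {X : Scheme.{u}}

/-- Primes of the local ring at `x` are the generizations of `x`; this converts invertibility of a
germ at a generization into non-membership in the prime. -/
lemma fromSpecStalk_mem_basicOpen_iff {x : X} {V : X.Opens} (hx : x ∈ V) (r : Γ(X, V))
    (p : Spec (X.presheaf.stalk x)) :
    X.fromSpecStalk x p ∈ X.basicOpen r ↔ X.presheaf.germ V x hx r ∉ p.asIdeal := by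
  have h : X.fromSpecStalk x ⁻¹ᵁ X.basicOpen r =
      PrimeSpectrum.basicOpen (X.presheaf.germ V x hx r) := by
    rw [Scheme.preimage_basicOpen, Scheme.fromSpecStalk_app hx]
    simp only [CommRingCat.comp_apply]
    rw [Scheme.basicOpen_res, basicOpen_eq_of_affine']
    have : X.fromSpecStalk x ⁻¹ᵁ V = ⊤ := by
      ext y
      have : X.fromSpecStalk x y ∈ Set.range (X.fromSpecStalk x) := ⟨y, rfl⟩
      rw [Scheme.range_fromSpecStalk] at this
      simpa using Specializes.mem_open this V.2 hx
    rw [this]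
    refine (top_inf_eq _).trans ?_
    congr 1
    exact Iso.inv_hom_id_apply _ _
  exact SetLike.ext_iff.mp h p

/-- Generizations are larger in the specialization order, so `Order.coheight` is codimension and its
zeros are the maximal points. -/
lemma mem_genericPoints_of_coheight_eq_zero {x : X} (h : Order.coheight x = 0) :
    x ∈ genericPoints X := by
  rw [Order.coheight_eq_zero] at h
  obtain ⟨Z, hZ, hxZ⟩ := exists_mem_irreducibleComponents_subset_of_isIrreducible (closure {x})
    isIrreducible_singleton.closure
  obtain ⟨y, hy⟩ := QuasiSober.sober hZ.1 (isClosed_of_mem_irreducibleComponents Z hZ)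
  have h1 : y ⤳ x := by
    rw [specializes_iff_mem_closure, hy]
    exact hxZ (subset_closure rfl)
  have h2 : x ⤳ y := h h1
  have : x = y := (h2.antisymm h1).eq
  subst this
  show closure {x} ∈ irreducibleComponents X
  rwa [show closure {x} = Z from hy]

lemma coheight_eq_zero_of_mem_genericPoints {x : X} (h : x ∈ genericPoints X) :
    Order.coheight x = 0 := by
  rw [Order.coheight_eq_zero]
  intro y (hy : y ⤳ x)
  show x ⤳ y
  have h1 : closure {x} ⊆ closure {y} := closure_minimal (by
    simpa using specializes_iff_mem_closure.mp hy) isClosed_closure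
  have := h.2 isIrreducible_singleton.closure h1
  rw [specializes_iff_mem_closure]
  exact this (subset_closure rfl)

lemma coheight_ne_top [IsLocallyNoetherian X] (x : X) : Order.coheight x ≠ ⊤ := by
  intro h
  have := ringKrullDim_stalk_eq_coheight x
  rw [h] at this
  exact ringKrullDim_ne_top this

/-- A prime `p ⊇ J x` other than the maximal ideal is a proper generization of smaller codimension.
There `J` is the unit ideal by induction, so `hloc` puts into `J x` an element outside `p`, a
contradiction. Hence `hstep` applies. -/
theorem ideal_eq_top_of_generization [IsLocallyNoetherian X] (U : X.Opens)
    (J : ∀ x : X, Ideal (X.presheaf.stalk x))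
    (hloc : ∀ (x y : X) (_ : x ∈ U) (h : y ⤳ x), J y = ⊤ →
      ∃ u ∈ J x, IsUnit (X.presheaf.stalkSpecializes h u))
    (hstep : ∀ x ∈ U, IsLocalRing.maximalIdeal _ ≤ (J x).radical → J x = ⊤) :
    ∀ x ∈ U, J x = ⊤ := by
  suffices ∀ n : ℕ∞, ∀ x ∈ U, Order.coheight x = n → J x = ⊤ from fun x hx => this _ x hx rfl
  intro n
  induction n using WellFoundedLT.induction with
  | ind n ih =>
  intro x hxU hxn
  apply hstep x hxU
  intro a ha
  rw [Ideal.radical_eq_sInf, Ideal.mem_sInf]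
  rintro p ⟨hJp, hp⟩
  by_contra hap
  let q : Spec (X.presheaf.stalk x) := ⟨p, hp⟩
  have hqx : X.fromSpecStalk x q ⤳ x := by
    have : X.fromSpecStalk x q ∈ Set.range (X.fromSpecStalk x) := ⟨q, rfl⟩
    rwa [Scheme.range_fromSpecStalk] at this
  have hne : ¬ x ⤳ X.fromSpecStalk x q := by
    intro h
    have h1 : X.fromSpecStalk x q = X.fromSpecStalk x (IsLocalRing.closedPoint _) := by
      rw [Scheme.fromSpecStalk_closedPoint]
      exact (hqx.antisymm h).eq
    have h2 := (X.fromSpecStalk x).isEmbedding.injective h1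
    apply hap
    have h3 : p = IsLocalRing.maximalIdeal _ := congrArg PrimeSpectrum.asIdeal h2
    rwa [h3]
  have hlt : Order.coheight (X.fromSpecStalk x q) < n := by
    rw [← hxn]
    -- Strict decrease needs finite codimension, which holds because noetherian local rings have
    -- finite dimension.
    exact Order.coheight_strictAnti ⟨hqx, hne⟩ (coheight_ne_top _).lt_top
  obtain ⟨u, hu, hy⟩ := hloc x _ hxU hqx (ih _ hlt _ (hqx.mem_open U.2 hxU) rfl)
  obtain ⟨V, hx, r, rfl⟩ := TopCat.Presheaf.exists_germ_eq X.presheaf u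
  rw [TopCat.Presheaf.germ_stalkSpecializes_apply, ← Scheme.mem_basicOpen] at hy
  exact (fromSpecStalk_mem_basicOpen_iff hx r q).mp hy (hJp hu)

end Generization

/-! ### Sections of quasi-coherent modules over basic open sets. -/

section QuasiCoherent

variable {X : Scheme.{u}} (F : X.Modules)

/-- The basic open subset `D(r)` of `Spec R`, as an open subset of a scheme. -/
abbrev specBasicOpen {R : CommRingCat.{u}} (r : R) : (Spec R).Opens := PrimeSpectrum.basicOpen r

lemma isLocalizedModule_restrict_fromSpec [F.IsQuasicoherent] {V : X.Opens} (hV : IsAffineOpen V)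
    (r : Γ(X, V)) :
    IsLocalizedModule (.powers r) ((modulesSpecToSheaf.obj (F.restrict hV.fromSpec)).obj.map
      (specBasicOpen r).leTop.op).hom := by
  have : (F.restrict hV.fromSpec).IsQuasicoherent := inferInstance
  exact (isIso_fromTildeΓ_iff_isLocalizing _).mp
    (inferInstance : IsIso (F.restrict hV.fromSpec).fromTildeΓ) r

/-- Compatibility of scalars, needed to make the transport of sections between the spectrum and `X`
linear over `Γ(X, V)`. -/
lemma fromSpec_appIso_inv {V : X.Opens} (hV : IsAffineOpen V) {W : (Spec Γ(X, V)).Opens}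
    (h : hV.fromSpec ''ᵁ W ≤ V) (r : Γ(X, V)) :
    (hV.fromSpec.appIso W).inv ((Spec Γ(X, V)).presheaf.map W.leTop.op
      ((Scheme.ΓSpecIso Γ(X, V)).inv r)) = X.presheaf.map (homOfLE h).op r := by
  have : (Scheme.ΓSpecIso Γ(X, V)).inv ≫ (Spec Γ(X, V)).presheaf.map W.leTop.op =
      X.presheaf.map (homOfLE h).op ≫ (hV.fromSpec.appIso W).hom := by
    rw [Scheme.Hom.appIso_hom', Scheme.Hom.map_appLE, Scheme.Hom.appLE, hV.fromSpec_app_self,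
      Category.assoc, ← Functor.map_comp]
    rfl
  have h2 := congr((hV.fromSpec.appIso W).inv ($this r))
  simpa using h2

/-- Sections of the restriction of `F` to the spectrum of an affine open, as sections of `F`. -/
def restrictFromSpecEquiv {V : X.Opens} (hV : IsAffineOpen V) {W : (Spec Γ(X, V)).Opens}
    {U : X.Opens} (h : hV.fromSpec ''ᵁ W = U) : Γ(F.restrict hV.fromSpec, W) ≃+ Γ(F, U) :=
  ((F.restrictAppIso hV.fromSpec W) ≪≫
    F.presheaf.mapIso (eqToIso h.symm).op).addCommGroupIsoToAddEquiv

lemma restrictFromSpecEquiv_apply {V : X.Opens} (hV : IsAffineOpen V) {W : (Spec Γ(X, V)).Opens}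
    {U : X.Opens} (h : hV.fromSpec ''ᵁ W = U) (s : Γ(F.restrict hV.fromSpec, W)) :
    restrictFromSpecEquiv F hV h s = F.presheaf.map (homOfLE h.ge).op
      ((F.restrictAppIso hV.fromSpec W).hom s) := rfl

lemma restrictFromSpecEquiv_smul {V : X.Opens} (hV : IsAffineOpen V) {W : (Spec Γ(X, V)).Opens}
    {U : X.Opens} (h : hV.fromSpec ''ᵁ W = U) (hU : U ≤ V) (r : Γ(X, V))
    (s : Γ(F.restrict hV.fromSpec, W)) :
    restrictFromSpecEquiv F hV h (r • s) =
      X.presheaf.map (homOfLE hU).op r • restrictFromSpecEquiv F hV h s := by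
  subst h
  rw [restrictFromSpecEquiv_apply, Scheme.Modules.smul_Spec_def]
  erw [Scheme.Modules.smul_restrictAppIso_hom_apply]
  erw [Scheme.Modules.map_smul]
  erw [fromSpec_appIso_inv hV hU r]
  rw [restrictFromSpecEquiv_apply]
  congr 1
  simp

lemma restrictFromSpecEquiv_map {V : X.Opens} (hV : IsAffineOpen V) {W W' : (Spec Γ(X, V)).Opens}
    {U U' : X.Opens} (h : hV.fromSpec ''ᵁ W = U) (h' : hV.fromSpec ''ᵁ W' = U') (i : W' ⟶ W)
    (j : U' ⟶ U) (s : Γ(F.restrict hV.fromSpec, W)) :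
    restrictFromSpecEquiv F hV h' ((F.restrict hV.fromSpec).presheaf.map i.op s) =
      F.presheaf.map j.op (restrictFromSpecEquiv F hV h s) := by
  subst h h'
  change (F.presheaf.map (hV.fromSpec.opensFunctor.map i).op ≫ F.presheaf.map _) s =
    (F.presheaf.map _ ≫ F.presheaf.map j.op) s
  rw [← Functor.map_comp, ← Functor.map_comp]
  rfl

lemma fromSpec_image_top {V : X.Opens} (hV : IsAffineOpen V) : hV.fromSpec ''ᵁ ⊤ = V := by
  simp

/-- Sections over a basic open are the localization of those over `V`. The later arguments use this
only through this kernel statement and the extension statement `exists_res_eq_pow_smul`. -/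
lemma exists_pow_smul_eq_zero_of_res_eq_zero [F.IsQuasicoherent] {V : X.Opens} (hV : IsAffineOpen V)
    (r : Γ(X, V)) (s : Γ(F, V)) (hs : F.presheaf.map (homOfLE (X.basicOpen_le r)).op s = 0) :
    ∃ n : ℕ, r ^ n • s = 0 := by
  have h := isLocalizedModule_restrict_fromSpec F hV r
  have hW : hV.fromSpec ''ᵁ specBasicOpen r = X.basicOpen r := hV.fromSpec_image_basicOpen r
  obtain ⟨t, rfl⟩ := (restrictFromSpecEquiv F hV (fromSpec_image_top hV)).surjective s
  rw [← restrictFromSpecEquiv_map F hV (fromSpec_image_top hV) hW (specBasicOpen r).leTop,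
    map_eq_zero_iff _ (AddEquiv.injective _)] at hs
  obtain ⟨⟨_, n, rfl⟩, hn⟩ := (IsLocalizedModule.eq_zero_iff (.powers r)
    ((modulesSpecToSheaf.obj (F.restrict hV.fromSpec)).obj.map (specBasicOpen r).leTop.op).hom).mp hs
  refine ⟨n, ?_⟩
  have := restrictFromSpecEquiv_smul F hV (fromSpec_image_top hV) le_rfl (r ^ n) t
  rw [show (homOfLE le_rfl : V ⟶ V) = 𝟙 V from rfl, op_id, X.presheaf.map_id] at this
  exact this.symm.trans ((congrArg _ hn).trans (map_zero _))

lemma exists_res_eq_pow_smul [F.IsQuasicoherent] {V : X.Opens} (hV : IsAffineOpen V)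
    (r : Γ(X, V)) (t : Γ(F, X.basicOpen r)) :
    ∃ (n : ℕ) (s : Γ(F, V)), F.presheaf.map (homOfLE (X.basicOpen_le r)).op s =
      X.presheaf.map (homOfLE (X.basicOpen_le r)).op r ^ n • t := by
  have h := isLocalizedModule_restrict_fromSpec F hV r
  have hW : hV.fromSpec ''ᵁ specBasicOpen r = X.basicOpen r := hV.fromSpec_image_basicOpen r
  obtain ⟨t, rfl⟩ := (restrictFromSpecEquiv F hV hW).surjective t
  obtain ⟨⟨s, ⟨_, n, rfl⟩⟩, hn⟩ := IsLocalizedModule.surj (.powers r)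
    ((modulesSpecToSheaf.obj (F.restrict hV.fromSpec)).obj.map (specBasicOpen r).leTop.op).hom t
  refine ⟨n, restrictFromSpecEquiv F hV (fromSpec_image_top hV) s, ?_⟩
  refine (restrictFromSpecEquiv_map F hV (fromSpec_image_top hV) hW (specBasicOpen r).leTop _
    s).symm.trans ?_
  rw [← map_pow, ← restrictFromSpecEquiv_smul F hV hW]
  exact congrArg _ hn.symm

lemma germ_smul {U : X.Opens} {x : X} (hx : x ∈ U) (r : Γ(X, U)) (s : Γ(F, U)) :
    F.presheaf.germ U x hx (r • s) = X.presheaf.germ U x hx r • F.presheaf.germ U x hx s :=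
  PresheafOfModules.germ_smul (R := X.presheaf) F.val x U hx r s

end QuasiCoherent

/-! ### Powers of a regular pair. -/

section Regular

variable {A : Type*} [CommRing A] {M : Type*} [AddCommGroup M] [Module A M]

/-- The hypothesis `hb` is regularity of `b` on `M / aM`, unfolded. Cancel the factors `b` one at a
time modulo `a`, then peel off the factors `a` one at a time by regularity of `a`. -/
lemma exists_eq_pow_smul {a b : A} (ha : IsSMulRegular M a)
    (hb : ∀ z w : M, b • z = a • w → ∃ w', z = a • w') (k n : ℕ) (z w : M)
    (h : b ^ k • z = a ^ n • w) : ∃ w', z = a ^ n • w' := by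
  have hbk : ∀ k : ℕ, ∀ z w : M, b ^ k • z = a • w → ∃ w', z = a • w' := by
    intro k
    induction k with
    | zero => exact fun z w h => ⟨w, by simpa using h⟩
    | succ k ih =>
      intro z w h
      rw [pow_succ, mul_smul] at h
      obtain ⟨w', hw'⟩ := ih _ _ h
      exact hb _ _ hw'
  induction n generalizing z w with
  | zero => exact ⟨z, by simp⟩
  | succ n ih =>
    rw [pow_succ', mul_smul] at h
    obtain ⟨z', rfl⟩ := hbk k _ _ h
    rw [smul_comm] at h
    obtain ⟨w', rfl⟩ := ih _ _ (ha h)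
    exact ⟨w', by rw [pow_succ', mul_smul]⟩

end Regular

/-! ### Regular elements and regular pairs from depth bounds. -/

section Depth

variable {A : Type*} [CommRing A] [IsLocalRing A] {M : Type*} [AddCommGroup M] [Module A M]

lemma exists_isWeaklyRegular_of_le_depth {n : ℕ} (h : (n : ℕ∞) + 1 ≤ depth A M) :
    ∃ rs : List A, (∀ r ∈ rs, r ∈ IsLocalRing.maximalIdeal A) ∧
      RingTheory.Sequence.IsWeaklyRegular M rs ∧ n + 1 ≤ rs.length := by
  have h1 : (n : ℕ∞) < depth A M :=
    lt_of_lt_of_le (ENat.lt_add_one_iff (ENat.natCast_ne_top n) |>.mpr le_rfl) h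
  rw [depth, lt_iSup_iff] at h1
  obtain ⟨rs, h1⟩ := h1
  rw [lt_iSup_iff] at h1
  obtain ⟨h2, h1⟩ := h1
  exact ⟨rs, h2.1, h2.2, by exact_mod_cast h1⟩

lemma exists_isSMulRegular_of_one_le_depth (h : 1 ≤ depth A M) :
    ∃ a ∈ IsLocalRing.maximalIdeal A, IsSMulRegular M a := by
  obtain ⟨rs, hm, hreg, hlen⟩ := exists_isWeaklyRegular_of_le_depth (n := 0) (by simpa using h)
  match rs, hlen with
  | a :: l, _ =>
    rw [RingTheory.Sequence.isWeaklyRegular_cons_iff] at hreg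
    exact ⟨a, hm a (by simp), hreg.1⟩

lemma exists_regular_pair_of_two_le_depth (h : 2 ≤ depth A M) :
    ∃ a ∈ IsLocalRing.maximalIdeal A, ∃ b ∈ IsLocalRing.maximalIdeal A, IsSMulRegular M a ∧
      ∀ z w : M, b • z = a • w → ∃ w', z = a • w' := by
  obtain ⟨rs, hm, hreg, hlen⟩ := exists_isWeaklyRegular_of_le_depth (n := 1)
    (by simpa [one_add_one_eq_two] using h)
  match rs, hlen with
  | a :: b :: l, _ =>
    rw [RingTheory.Sequence.isWeaklyRegular_cons_iff,
      RingTheory.Sequence.isWeaklyRegular_cons_iff] at hreg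
    refine ⟨a, hm a (by simp), b, hm b (by simp), hreg.1, fun z w hzw => ?_⟩
    have h0 : b • (Submodule.Quotient.mk z : QuotSMulTop a M) = b • 0 := by
      rw [smul_zero, ← Submodule.Quotient.mk_smul, Submodule.Quotient.mk_eq_zero, hzw]
      exact Submodule.smul_mem_pointwise_smul _ _ _ trivial
    have h1 := hreg.2.1 h0
    rw [Submodule.Quotient.mk_eq_zero, Submodule.mem_smul_pointwise_iff_exists] at h1
    obtain ⟨w', -, hw'⟩ := h1
    exact ⟨w', hw'.symm⟩

lemma depth_eq_of_linearEquiv {N : Type*} [AddCommGroup N] [Module A N] (e : M ≃ₗ[A] N) :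
    depth A M = depth A N := by
  simp only [depth, e.isWeaklyRegular_congr]

end Depth

/-! ### Sections of `S_2` sheaves vanish if they vanish generically. -/

section Vanishing

variable {X : Scheme.{u}}

lemma exists_isAffineOpen_mem_le {U : X.Opens} {x : X} (hx : x ∈ U) :
    ∃ V : X.Opens, IsAffineOpen V ∧ x ∈ V ∧ V ≤ U :=
  exists_isAffineOpen_mem_and_subset hx

lemma one_le_depth {M : Type*} [AddCommGroup M] {x : X} [Module (X.presheaf.stalk x) M]
    (h : min ((2 : ℕ) : WithBot ℕ∞) (ringKrullDim (X.presheaf.stalk x)) ≤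
      (depth (X.presheaf.stalk x) M : WithBot ℕ∞)) (hx : x ∉ genericPoints X) :
    1 ≤ depth (X.presheaf.stalk x) M := by
  have h0 : Order.coheight x ≠ 0 := fun h => hx (mem_genericPoints_of_coheight_eq_zero h)
  have h1 : (1 : ℕ∞) ≤ Order.coheight x := Order.one_le_iff_ne_zero.mpr h0
  rw [ringKrullDim_stalk_eq_coheight] at h
  have h2 : ((1 : ℕ∞) : WithBot ℕ∞) ≤ min ((2 : ℕ) : WithBot ℕ∞) (Order.coheight x : ℕ∞) :=
    le_min (by norm_cast) (by exact_mod_cast h1)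
  exact_mod_cast h2.trans h

lemma two_le_depth {M : Type*} [AddCommGroup M] {x : X} [Module (X.presheaf.stalk x) M]
    (h : min ((2 : ℕ) : WithBot ℕ∞) (ringKrullDim (X.presheaf.stalk x)) ≤
      (depth (X.presheaf.stalk x) M : WithBot ℕ∞))
    (hx : ¬ ringKrullDim (X.presheaf.stalk x) ≤ 1) :
    2 ≤ depth (X.presheaf.stalk x) M := by
  rw [ringKrullDim_stalk_eq_coheight] at h hx
  have h1 : (2 : ℕ∞) ≤ Order.coheight x := by
    rw [← one_add_one_eq_two]
    refine Order.add_one_le_of_lt ?_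
    by_contra hc
    exact hx (by exact_mod_cast not_lt.mp hc)
  have h2 : ((2 : ℕ∞) : WithBot ℕ∞) ≤ min ((2 : ℕ) : WithBot ℕ∞) (Order.coheight x : ℕ∞) :=
    le_min (by norm_cast) (by exact_mod_cast h1)
  exact_mod_cast h2.trans h

lemma exists_res_eq_zero_of_germ_eq_zero (F : X.Modules) {U : X.Opens} (s : Γ(F, U)) {y : X}
    (hy : y ∈ U)
    (h : F.presheaf.germ U y hy s = 0) :
    ∃ (W : X.Opens) (hW : W ≤ U), y ∈ W ∧ F.presheaf.map (homOfLE hW).op s = 0 := by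
  obtain ⟨W, hyW, i, j, hij⟩ := TopCat.Presheaf.germ_eq F.presheaf y hy hy s 0 (by rw [h, map_zero])
  exact ⟨W, i.le, hyW, by rw [map_zero] at hij; exact hij⟩

/-- Inside an affine neighbourhood of `x` the section vanishes on some basic open `D(r)` containing
`y`; a power of `r` kills it, and `r` is a unit at `y`. -/
lemma exists_smul_germ_eq_zero (F : X.Modules) [F.IsQuasicoherent] {U : X.Opens} (s : Γ(F, U))
    {x y : X} (hx : x ∈ U) (hyx : y ⤳ x)
    (hy : F.presheaf.germ U y (hyx.mem_open U.2 hx) s = 0) :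
    ∃ u, u • F.presheaf.germ U x hx s = 0 ∧ IsUnit (X.presheaf.stalkSpecializes hyx u) := by
  obtain ⟨W, hWU, hyW, hW⟩ := exists_res_eq_zero_of_germ_eq_zero F s _ hy
  obtain ⟨V, hV, hxV, hVU⟩ := exists_isAffineOpen_mem_le hx
  obtain ⟨r, hrW, hyr⟩ := hV.exists_basicOpen_le ⟨y, hyW⟩ (hyx.mem_open V.2 hxV)
  obtain ⟨n, hn⟩ := exists_pow_smul_eq_zero_of_res_eq_zero F hV r
    (F.presheaf.map (homOfLE hVU).op s) (by
      rw [← CategoryTheory.comp_apply, ← Functor.map_comp]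
      have := congr(F.presheaf.map (homOfLE hrW).op $hW)
      rw [← CategoryTheory.comp_apply, ← Functor.map_comp, map_zero] at this
      exact this)
  refine ⟨X.presheaf.germ V x hxV (r ^ n), ?_, ?_⟩
  · have := congr(F.presheaf.germ V x hxV $hn)
    rwa [map_zero, germ_smul, TopCat.Presheaf.germ_res_apply] at this
  · rw [TopCat.Presheaf.germ_stalkSpecializes_apply, map_pow]
    exact ((Scheme.mem_basicOpen _ _ _ _).mp hyr).pow n

lemma exists_mul_germ_eq_zero {U : X.Opens} (s : Γ(X, U)) {x y : X} (hx : x ∈ U) (hyx : y ⤳ x)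
    (hy : X.presheaf.germ U y (hyx.mem_open U.2 hx) s = 0) :
    ∃ u, u * X.presheaf.germ U x hx s = 0 ∧ IsUnit (X.presheaf.stalkSpecializes hyx u) := by
  obtain ⟨W, hyW, i, j, hW⟩ := TopCat.Presheaf.germ_eq X.presheaf y (hyx.mem_open U.2 hx)
    (hyx.mem_open U.2 hx) s 0 (by rw [hy, map_zero])
  obtain ⟨V, hV, hxV, hVU⟩ := exists_isAffineOpen_mem_le hx
  obtain ⟨r, hrW, hyr⟩ := hV.exists_basicOpen_le ⟨y, hyW⟩ (hyx.mem_open V.2 hxV)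
  obtain ⟨n, hn⟩ := exists_pow_mul_eq_zero_of_res_basicOpen_eq_zero_of_isAffineOpen X hV
    (X.presheaf.map (homOfLE hVU).op s) r (by
      change X.presheaf.map (homOfLE (X.basicOpen_le r)).op _ = 0
      rw [← CategoryTheory.comp_apply, ← Functor.map_comp]
      have := congr(X.presheaf.map (homOfLE hrW).op $hW)
      rw [map_zero, map_zero, ← CategoryTheory.comp_apply, ← Functor.map_comp] at this
      exact this)
  refine ⟨X.presheaf.germ V x hxV (r ^ n), ?_, ?_⟩
  · have := congr(X.presheaf.germ V x hxV $hn)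
    rwa [map_zero, map_mul, TopCat.Presheaf.germ_res_apply] at this
  · rw [TopCat.Presheaf.germ_stalkSpecializes_apply, map_pow]
    exact ((Scheme.mem_basicOpen _ _ _ _).mp hyr).pow n

/-- If the modules `M x` satisfy `S_1`, a family of elements of the `M x` that vanishes at the
generic points and satisfies the localization property of sections of quasi-coherent sheaves
vanishes. -/
lemma family_eq_zero [IsLocallyNoetherian X] {M : X → Type*} [∀ x, AddCommGroup (M x)]
    [∀ x, Module (X.presheaf.stalk x) (M x)]
    (hM : ∀ x ∉ genericPoints X, 1 ≤ depth (X.presheaf.stalk x) (M x)) {U : X.Opens}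
    (s : ∀ x ∈ U, M x) (hs : ∀ η ∈ genericPoints X, ∀ hη : η ∈ U, s η hη = 0)
    (hloc : ∀ (x y : X) (hx : x ∈ U) (h : y ⤳ x), s y (h.mem_open U.2 hx) = 0 →
      ∃ u, u • s x hx = 0 ∧ IsUnit (X.presheaf.stalkSpecializes h u)) (x : X) (hx : x ∈ U) :
    s x hx = 0 := by
  -- The annihilator of `s x`; the infimum over proofs of `x ∈ U` merely extends it by `⊤` outside
  -- `U`.
  let J : ∀ x : X, Ideal (X.presheaf.stalk x) := fun x => ⨅ hx : x ∈ U,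
    LinearMap.ker (LinearMap.toSpanSingleton (X.presheaf.stalk x) _ (s x hx))
  have mem_J (x : X) (hx : x ∈ U) (u) : u ∈ J x ↔ u • s x hx = 0 := by
    simp [J, hx]
  have J_eq_top (x : X) (hx : x ∈ U) : J x = ⊤ ↔ s x hx = 0 := by
    rw [Ideal.eq_top_iff_one, mem_J x hx, one_smul]
  refine (J_eq_top x hx).mp (ideal_eq_top_of_generization U J ?_ ?_ x hx)
  · intro x y hx hyx hy
    obtain ⟨u, hu, hu'⟩ := hloc x y hx hyx ((J_eq_top y _).mp hy)
    exact ⟨u, (mem_J x hx u).mpr hu, hu'⟩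
  · intro x hx hm
    rw [J_eq_top x hx]
    by_cases hη : x ∈ genericPoints X
    · exact hs x hη hx
    obtain ⟨a, ha, hreg⟩ := exists_isSMulRegular_of_one_le_depth (hM x hη)
    obtain ⟨n, hn⟩ := hm ha
    rw [mem_J x hx] at hn
    exact (hreg.pow n).right_eq_zero_of_smul hn

theorem eq_zero_of_germ_genericPoints_eq_zero [IsLocallyNoetherian X] {F : X.Modules}
    [F.IsQuasicoherent] (hF : SatisfiesSerre 2 F) {U : X.Opens} (s : Γ(F, U))
    (hs : ∀ η ∈ genericPoints X, ∀ hη : η ∈ U, F.presheaf.germ U η hη s = 0) : s = 0 :=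
  TopCat.Presheaf.section_ext ⟨F.presheaf, F.isSheaf⟩ U s 0 fun x hx => by
    rw [map_zero]
    exact family_eq_zero (fun x hx => one_le_depth (hF x) hx)
      (fun x hx => F.presheaf.germ U x hx s) hs
      (fun x y hx h hy => exists_smul_germ_eq_zero F s hx h hy) x hx

theorem section_eq_zero_of_germ_genericPoints_eq_zero [IsLocallyNoetherian X]
    (hX : SchemeSatisfiesSerre 2 X) {U : X.Opens} (s : Γ(X, U))
    (hs : ∀ η ∈ genericPoints X, ∀ hη : η ∈ U, X.presheaf.germ U η hη s = 0) : s = 0 :=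
  TopCat.Presheaf.section_ext X.sheaf U s 0 fun x hx => by
    rw [map_zero]
    exact family_eq_zero (fun x hx => one_le_depth (hX x) hx)
      (fun x hx => X.presheaf.germ U x hx s) hs
      (fun x y hx h hy => exists_mul_germ_eq_zero s hx h hy) x hx

end Vanishing

/-! ### Sections of `𝒦_X` and their values at the generic points. -/

section TotalQuotient

variable {X : Scheme.{u}}

lemma algebraMap_injective (x : X) :
    Function.Injective (algebraMap (X.presheaf.stalk x) (TotFrac X x)) :=
  IsFractionRing.injective _ _

lemma isUnit_algebraMap {x : X} {b : X.presheaf.stalk x}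
    (hb : b ∈ nonZeroDivisors (X.presheaf.stalk x)) :
    IsUnit (algebraMap (X.presheaf.stalk x) (TotFrac X x) b) :=
  IsLocalization.map_units (TotFrac X x) (⟨b, hb⟩ : nonZeroDivisors _)

lemma mul_mem_totalQuotientSheaf {U : X.Opens} {s t : Fam X U}
    (hs : s ∈ (totalQuotientSheaf X).obj U) (ht : t ∈ (totalQuotientSheaf X).obj U) :
    s * t ∈ (totalQuotientSheaf X).obj U := by
  intro x hx
  obtain ⟨V, hV, hxV, a, b, hab⟩ := hs x hx
  obtain ⟨W, hW, hxW, c, d, hcd⟩ := ht x hx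
  let ρ := fun r : Γ(X, V) => X.presheaf.map (homOfLE (inf_le_left : V ⊓ W ≤ V)).op r
  let σ := fun r : Γ(X, W) => X.presheaf.map (homOfLE (inf_le_right : V ⊓ W ≤ W)).op r
  refine ⟨V ⊓ W, inf_le_left.trans hV, ⟨hxV, hxW⟩, ρ a * σ c, ρ b * σ d, fun y => ?_⟩
  obtain ⟨h₁, h₂⟩ := hab ⟨y.1, y.2.1⟩
  obtain ⟨h₃, h₄⟩ := hcd ⟨y.1, y.2.2⟩
  simp only [ρ, σ, map_mul, TopCat.Presheaf.germ_res_apply, Pi.mul_apply]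
  refine ⟨mul_mem h₁ h₃, ?_⟩
  rw [← h₂, ← h₄]
  ring

lemma one_mem_totalQuotientSheaf (U : X.Opens) : (1 : Fam X U) ∈ (totalQuotientSheaf X).obj U :=
  fun x hx => ⟨U, le_rfl, hx, 1, 1, fun y => by simp [one_mem]⟩

/-- Denominators are invertible in the total fraction rings, so the claim reduces to the numerator.
-/
lemma exists_smul_apply_eq_zero {U : X.Opens} {s : Fam X U}
    (hs : s ∈ (totalQuotientSheaf X).obj U) {x y : X} (hx : x ∈ U) (hyx : y ⤳ x)
    (hy : s ⟨y, hyx.mem_open U.2 hx⟩ = 0) :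
    ∃ u : X.presheaf.stalk x, u • s ⟨x, hx⟩ = 0 ∧
      IsUnit (X.presheaf.stalkSpecializes hyx u) := by
  obtain ⟨V, hV, hxV, a, b, hab⟩ := hs x hx
  have hyV := hyx.mem_open V.2 hxV
  have hay := (hab ⟨y, hyV⟩).2
  rw [hy, mul_zero, eq_comm, map_eq_zero_iff _ (algebraMap_injective y)] at hay
  obtain ⟨u, hu, hu'⟩ := exists_mul_germ_eq_zero a hxV hyx hay
  refine ⟨u, ?_, hu'⟩
  obtain ⟨hb, h⟩ := hab ⟨x, hxV⟩
  rw [Algebra.smul_def, ← (isUnit_algebraMap hb).mul_right_eq_zero, mul_left_comm, h, ← map_mul, hu,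
    map_zero]

lemma apply_eq_zero_of_genericPoints [IsLocallyNoetherian X] (hX : SchemeSatisfiesSerre 2 X)
    {U : X.Opens} {s : Fam X U} (hs : s ∈ (totalQuotientSheaf X).obj U)
    (h : ∀ η ∈ genericPoints X, ∀ hη : η ∈ U, s ⟨η, hη⟩ = 0) : s = 0 := by
  funext ⟨x, hx⟩
  obtain ⟨V, hV, hxV, a, b, hab⟩ := hs x hx
  have ha : a = 0 := section_eq_zero_of_germ_genericPoints_eq_zero hX a fun η hη hηV => by
    have := (hab ⟨η, hηV⟩).2
    rwa [h η hη, mul_zero, eq_comm, map_eq_zero_iff _ (algebraMap_injective η)] at this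
  obtain ⟨hb, h⟩ := hab ⟨x, hxV⟩
  rwa [ha, map_zero, map_zero, (isUnit_algebraMap hb).mul_right_eq_zero] at h

lemma ext_of_genericPoints [IsLocallyNoetherian X] (hX : SchemeSatisfiesSerre 2 X)
    {U : X.Opens} {s t : Fam X U} (hs : s ∈ (totalQuotientSheaf X).obj U)
    (ht : t ∈ (totalQuotientSheaf X).obj U)
    (h : ∀ η ∈ genericPoints X, ∀ hη : η ∈ U, s ⟨η, hη⟩ = t ⟨η, hη⟩) : s = t :=
  sub_eq_zero.mp (apply_eq_zero_of_genericPoints hX (sub_mem hs ht)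
    fun η hη hηU => sub_eq_zero.mpr (h η hη hηU))

lemma isNilpotent_of_mem_genericPoints [IsLocallyNoetherian X] {η : X} (hη : η ∈ genericPoints X)
    {r : X.presheaf.stalk η} (hr : ¬ IsUnit r) : IsNilpotent r := by
  have : Ring.KrullDimLE 0 (X.presheaf.stalk η) :=
    krullDimLE_of_coheight_le (coheight_eq_zero_of_mem_genericPoints hη).le
  exact Ring.KrullDimLE.isNilpotent_iff_mem_maximalIdeal.mpr hr

lemma isUnit_of_mem_nonZeroDivisors [IsLocallyNoetherian X] {η : X} (hη : η ∈ genericPoints X)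
    {r : X.presheaf.stalk η} (hr : r ∈ nonZeroDivisors (X.presheaf.stalk η)) : IsUnit r := by
  by_contra h
  obtain ⟨n, hn⟩ := isNilpotent_of_mem_genericPoints hη h
  exact zero_notMem_nonZeroDivisors (hn ▸ pow_mem hr n)

lemma algebraMap_bijective [IsLocallyNoetherian X] {η : X} (hη : η ∈ genericPoints X) :
    Function.Bijective (algebraMap (X.presheaf.stalk η) (TotFrac X η)) :=
  (IsLocalization.atUnits _ (nonZeroDivisors (X.presheaf.stalk η))
    fun _ => isUnit_of_mem_nonZeroDivisors hη).bijective

/-- Choose a function invertible at `η` whose basic open avoids the closure of `η'`. If `η'` lies in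
`V`, its germ there is a non-unit in a zero-dimensional local ring, hence nilpotent, and a power
vanishes at `η'`. -/
lemma exists_section_eq_zero_isUnit [IsLocallyNoetherian X] {V : X.Opens} (hV : IsAffineOpen V)
    {η η' : X} (hη : η ∈ genericPoints X) (hη' : η' ∈ genericPoints X) (hηV : η ∈ V)
    (hne : η' ≠ η) : ∃ e : Γ(X, V), IsUnit (X.presheaf.germ V η hηV e) ∧
      ∀ h : η' ∈ V, X.presheaf.germ V η' h e = 0 := by
  let W : X.Opens := ⟨(closure {η'})ᶜ, isClosed_closure.isOpen_compl⟩
  have hηW : η ∈ W := by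
    intro h
    have h1 : η' ⤳ η := specializes_iff_mem_closure.mpr h
    have h2 := Order.coheight_eq_zero.mp (coheight_eq_zero_of_mem_genericPoints hη) h1
    exact hne (Specializes.antisymm h1 h2).eq
  obtain ⟨r, hrW, hηr⟩ := hV.exists_basicOpen_le ⟨η, hηW⟩ hηV
  have hη'r : η' ∉ X.basicOpen r := fun h => hrW h (subset_closure rfl)
  by_cases h : η' ∈ V
  · rw [Scheme.mem_basicOpen _ _ _ h] at hη'r
    obtain ⟨n, hn⟩ := isNilpotent_of_mem_genericPoints hη' hη'r
    refine ⟨r ^ n, ?_, fun _ => by rw [map_pow, hn]⟩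
    rw [map_pow]
    exact ((Scheme.mem_basicOpen _ _ _ _).mp hηr).pow n
  · exact ⟨r, (Scheme.mem_basicOpen _ _ _ _).mp hηr, fun h' => absurd h' h⟩

/-- If `c * b = 0` near `y`, then `c` vanishes at all generic points nearby, hence vanishes because
`𝒪_X` is `S_2`. -/
lemma germ_mem_nonZeroDivisors [IsLocallyNoetherian X] (hX : SchemeSatisfiesSerre 2 X)
    {V : X.Opens} (b : Γ(X, V))
    (hb : ∀ η ∈ genericPoints X, ∀ hη : η ∈ V, IsUnit (X.presheaf.germ V η hη b))
    (y : X) (hy : y ∈ V) : X.presheaf.germ V y hy b ∈ nonZeroDivisors (X.presheaf.stalk y) := by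
  rw [mem_nonZeroDivisors_iff_right]
  intro c hc
  obtain ⟨W, hyW, c, rfl⟩ := TopCat.Presheaf.exists_germ_eq X.presheaf c
  obtain ⟨W', hyW', i, j, h⟩ := TopCat.Presheaf.germ_eq X.presheaf (U := W ⊓ V) (V := W ⊓ V) y
    (show y ∈ W ⊓ V from ⟨hyW, hy⟩) (show y ∈ W ⊓ V from ⟨hyW, hy⟩)
    (X.presheaf.map (homOfLE inf_le_left).op c * X.presheaf.map (homOfLE inf_le_right).op b) 0
    (by rw [map_zero, map_mul, TopCat.Presheaf.germ_res_apply, TopCat.Presheaf.germ_res_apply, hc])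
  have := section_eq_zero_of_germ_genericPoints_eq_zero hX
    (X.presheaf.map (i ≫ homOfLE inf_le_left).op c) fun η hη hηW' => by
      have := congr(X.presheaf.germ W' η hηW' $h)
      rw [map_zero, map_zero, TopCat.Presheaf.germ_res_apply, map_mul,
        TopCat.Presheaf.germ_res_apply, TopCat.Presheaf.germ_res_apply,
        (hb η hη (i.le hηW').2).mul_left_eq_zero] at this
      rw [TopCat.Presheaf.germ_res_apply, this]
  rw [← TopCat.Presheaf.germ_res_apply X.presheaf (i ≫ homOfLE inf_le_left) y hyW', this, map_zero]

lemma germ_algebraMap_mul_injective {V : X.Opens} {b : Γ(X, V)} {y : X} {hy : y ∈ V}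
    (hb : X.presheaf.germ V y hy b ∈ nonZeroDivisors (X.presheaf.stalk y)) {s t : TotFrac X y}
    (h : algebraMap _ (TotFrac X y) (X.presheaf.germ V y hy b) * s =
      algebraMap _ (TotFrac X y) (X.presheaf.germ V y hy b) * t) : s = t :=
  (isUnit_algebraMap hb).mul_left_cancel h

lemma exists_fraction_of_isAffineOpen [IsLocallyNoetherian X] {V : X.Opens} (hV : IsAffineOpen V)
    {η : X} (hη : η ∈ genericPoints X) (hηV : η ∈ V) (g : TotFrac X η) :
    ∃ a b : Γ(X, V), IsUnit (X.presheaf.germ V η hηV b) ∧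
      algebraMap _ (TotFrac X η) (X.presheaf.germ V η hηV b) * g =
        algebraMap _ (TotFrac X η) (X.presheaf.germ V η hηV a) := by
  obtain ⟨c, rfl⟩ := (algebraMap_bijective hη).2 g
  let : Algebra Γ(X, V) (X.presheaf.stalk η) := X.presheaf.algebra_section_stalk ⟨η, hηV⟩
  have : IsLocalization.AtPrime (X.presheaf.stalk η) (hV.primeIdealOf ⟨η, hηV⟩).asIdeal :=
    hV.isLocalization_stalk ⟨η, hηV⟩
  obtain ⟨⟨a, b⟩, hab⟩ := IsLocalization.surj (hV.primeIdealOf ⟨η, hηV⟩).asIdeal.primeCompl c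
  refine ⟨a, b, IsLocalization.map_units (X.presheaf.stalk η) b, ?_⟩
  rw [← map_mul, mul_comm]
  exact congrArg _ hab

/-- The finitely many generic points of `V` are separated by functions `E η`, units at `η` and zero
at the others; weighting local numerators and denominators by them yields one fraction with all
prescribed values. -/
lemma exists_fraction_of_genericPoints [IsNoetherian X] {V : X.Opens} (hV : IsAffineOpen V)
    (g : ∀ η : X, TotFrac X η) : ∃ a b : Γ(X, V), ∀ η ∈ genericPoints X, ∀ hηV : η ∈ V,
      IsUnit (X.presheaf.germ V η hηV b) ∧
      algebraMap _ (TotFrac X η) (X.presheaf.germ V η hηV b) * g η =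
        algebraMap _ (TotFrac X η) (X.presheaf.germ V η hηV a) := by
  classical
  have hfin : (genericPoints X).Finite :=
    genericPoints.finite finite_irreducibleComponents_of_isNoetherian
  let S := hfin.toFinset.filter (· ∈ V)
  have hS (η : X) : η ∈ S ↔ η ∈ genericPoints X ∧ η ∈ V := by simp [S]
  have he (η η' : S) : ∃ e : Γ(X, V), IsUnit (X.presheaf.germ V η.1 ((hS _).mp η.2).2 e) ∧
      (η' ≠ η → X.presheaf.germ V η'.1 ((hS _).mp η'.2).2 e = 0) := by
    by_cases h : η' = η
    · exact ⟨1, by simp, fun h' => absurd h h'⟩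
    · obtain ⟨e, he, he'⟩ := exists_section_eq_zero_isUnit hV ((hS _).mp η.2).1 ((hS _).mp η'.2).1
        ((hS _).mp η.2).2 (fun h' => h (Subtype.ext h'))
      exact ⟨e, he, fun _ => he' _⟩
  choose e he he' using he
  choose α σ hσ hα using fun η : S => exists_fraction_of_isAffineOpen hV ((hS _).mp η.2).1
    ((hS _).mp η.2).2 (g η)
  let E (η : S) : Γ(X, V) := ∏ η', e η η'
  have hE (η : S) : IsUnit (X.presheaf.germ V η.1 ((hS _).mp η.2).2 (E η)) := by
    rw [map_prod]
    exact IsUnit.prod_univ_iff.mpr fun η' => he η η'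
  have hE' (η η' : S) (h : η' ≠ η) : X.presheaf.germ V η'.1 ((hS _).mp η'.2).2 (E η) = 0 := by
    rw [map_prod]
    exact Finset.prod_eq_zero (Finset.mem_univ η') (he' η η' h)
  have key (c : S → Γ(X, V)) (η : S) : X.presheaf.germ V η.1 ((hS _).mp η.2).2 (∑ η', E η' * c η') =
      X.presheaf.germ V η.1 ((hS _).mp η.2).2 (E η) *
        X.presheaf.germ V η.1 ((hS _).mp η.2).2 (c η) := by
    rw [map_sum, Finset.sum_eq_single η, map_mul]
    · intro η' _ h
      rw [map_mul, hE' η' η h.symm, zero_mul]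
    · simp
  refine ⟨∑ η, E η * α η, ∑ η, E η * σ η, fun η hη hηV => ?_⟩
  let η₀ : S := ⟨η, (hS η).mpr ⟨hη, hηV⟩⟩
  have h1 := key σ η₀
  have h2 := key α η₀
  refine ⟨?_, ?_⟩
  · exact h1 ▸ (hE η₀).mul (hσ η₀)
  · refine (congrArg (algebraMap _ (TotFrac X η) · * g η) h1).trans ?_
    refine Eq.trans ?_ (congrArg (algebraMap _ (TotFrac X η)) h2).symm
    rw [map_mul, map_mul, mul_assoc]
    exact congrArg _ (hα η₀)

lemma exists_section_of_isAffineOpen [IsNoetherian X] (hX : SchemeSatisfiesSerre 2 X)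
    {V : X.Opens} (hV : IsAffineOpen V) (g : ∀ η : X, TotFrac X η) :
    ∃ s ∈ (totalQuotientSheaf X).obj V, ∀ η ∈ genericPoints X, ∀ hη : η ∈ V, s ⟨η, hη⟩ = g η := by
  obtain ⟨a, b, hab⟩ := exists_fraction_of_genericPoints hV g
  have hb (y : V) := germ_mem_nonZeroDivisors hX b (fun η hη hηV => (hab η hη hηV).1) y.1 y.2
  let s : Fam X V := fun y => IsLocalization.mk' (TotFrac X y.1) (X.presheaf.germ V y.1 y.2 a)
    ⟨X.presheaf.germ V y.1 y.2 b, hb y⟩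
  have hs (y : V) : algebraMap _ (TotFrac X y.1) (X.presheaf.germ V y.1 y.2 b) * s y =
      algebraMap _ (TotFrac X y.1) (X.presheaf.germ V y.1 y.2 a) :=
    IsLocalization.mk'_spec' (TotFrac X y.1) (X.presheaf.germ V y.1 y.2 a)
      ⟨X.presheaf.germ V y.1 y.2 b, hb y⟩
  refine ⟨s, fun x hx => ⟨V, le_rfl, hx, a, b, fun y => ⟨hb y, hs y⟩⟩, fun η hη hηV => ?_⟩
  exact germ_algebraMap_mul_injective (hb ⟨η, hηV⟩)
    ((hs ⟨η, hηV⟩).trans (hab η hη hηV).2.symm)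

/-- Sections of `𝒦_X` are determined by, and can be prescribed by, their values at the generic
points. -/
theorem exists_section_of_genericPoints [IsNoetherian X] (hX : SchemeSatisfiesSerre 2 X)
    (U : X.Opens) (g : ∀ η : X, TotFrac X η) :
    ∃ s ∈ (totalQuotientSheaf X).obj U, ∀ η ∈ genericPoints X, ∀ hη : η ∈ U, s ⟨η, hη⟩ = g η := by
  choose V hV hxV hVU using fun x : U => exists_isAffineOpen_mem_le x.2
  choose s hs hsg using fun x : U => exists_section_of_isAffineOpen hX (hV x) g
  let t : Fam X U := fun x => s x ⟨x.1, hxV x⟩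
  have ht (x : U) : Fam.res (hVU x) t = s x := by
    -- Two local solutions agree on the overlap because they have the same values at the generic
    -- points.
    funext ⟨y, hy⟩
    let y' : U := ⟨y, hVU x hy⟩
    have := ext_of_genericPoints hX (U := V y' ⊓ V x)
      ((totalQuotientSheaf X).res_mem inf_le_left (hs y'))
      ((totalQuotientSheaf X).res_mem inf_le_right (hs x))
      fun η hη hηV => (hsg y' η hη hηV.1).trans (hsg x η hη hηV.2).symm
    exact congrFun this ⟨y, hxV y', hy⟩
  refine ⟨t, (totalQuotientSheaf X).glue t fun x hx => ⟨V ⟨x, hx⟩, hVU _, hxV _, ?_⟩, ?_⟩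
  · rw [ht]
    exact hs _
  · intro η hη hηU
    exact hsg ⟨η, hηU⟩ η hη (hxV ⟨η, hηU⟩)

end TotalQuotient

/-! ### Stalks of modules and of subsheaves; `S_2` ideals are saturated. -/

section Stalks

variable {X : Scheme.{u}}

/-- A family of additive maps out of the sections of `F` near `x` that is compatible with
restrictions and with scalars induces a linear map on the stalk. -/
lemma exists_linearMap_stalk (F : X.Modules) (x : X) {N : Type*} [AddCommGroup N]
    [Module (X.presheaf.stalk x) N] (f : ∀ U : X.Opens, x ∈ U → Γ(F, U) →+ N)
    (hres : ∀ (U V : X.Opens) (hx : x ∈ V) (i : V ⟶ U) (s : Γ(F, U)),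
      f V hx (F.presheaf.map i.op s) = f U (i.le hx) s)
    (hsmul : ∀ (U : X.Opens) (hx : x ∈ U) (r : Γ(X, U)) (s : Γ(F, U)),
      f U hx (r • s) = X.presheaf.germ U x hx r • f U hx s) :
    ∃ l : F.presheaf.stalk x →ₗ[X.presheaf.stalk x] N,
      ∀ (U : X.Opens) (hx : x ∈ U) (s : Γ(F, U)), l (F.presheaf.germ U x hx s) = f U hx s := by
  -- The map is defined through a chosen representative of each germ; `key` shows independence of
  -- the choice, from which linearity follows.
  choose U hU s hs using fun q : F.presheaf.stalk x => TopCat.Presheaf.exists_germ_eq F.presheaf q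
  have key (V : X.Opens) (hx : x ∈ V) (t : Γ(F, V)) :
      f _ (hU (F.presheaf.germ V x hx t)) (s (F.presheaf.germ V x hx t)) = f V hx t := by
    obtain ⟨W, hW, i, j, h⟩ := TopCat.Presheaf.germ_eq F.presheaf x _ _ _ _
      (hs (F.presheaf.germ V x hx t))
    rw [← hres _ _ hW i, ← hres _ _ hW j]
    exact congrArg _ h
  refine ⟨{ toFun q := f _ (hU q) (s q), map_add' := fun p q => ?_, map_smul' := fun c q => ?_ }, key⟩
  · obtain ⟨V, hV, p, rfl⟩ := TopCat.Presheaf.exists_germ_eq F.presheaf p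
    obtain ⟨W, hW, q, rfl⟩ := TopCat.Presheaf.exists_germ_eq F.presheaf q
    have h : x ∈ V ⊓ W := ⟨hV, hW⟩
    rw [← TopCat.Presheaf.germ_res_apply F.presheaf (homOfLE (inf_le_left : V ⊓ W ≤ V)) x h p,
      ← TopCat.Presheaf.germ_res_apply F.presheaf (homOfLE (inf_le_right : V ⊓ W ≤ W)) x h q,
      ← map_add]
    simp only [key]
    rw [map_add]
  · obtain ⟨V, hV, p, rfl⟩ := TopCat.Presheaf.exists_germ_eq F.presheaf q
    obtain ⟨W, hW, r, rfl⟩ := TopCat.Presheaf.exists_germ_eq X.presheaf c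
    have h : x ∈ V ⊓ W := ⟨hV, hW⟩
    rw [← TopCat.Presheaf.germ_res_apply F.presheaf (homOfLE (inf_le_left : V ⊓ W ≤ V)) x h p,
      ← TopCat.Presheaf.germ_res_apply X.presheaf (homOfLE (inf_le_right : V ⊓ W ≤ W)) x h r,
      ← germ_smul]
    simp only [key]
    rw [hsmul]
    rfl

/-- The linear equivalence on stalks induced by an isomorphism of modules. -/
lemma exists_linearEquiv_stalk {F G : X.Modules} (φ : F ≅ G) (x : X) :
    ∃ e : F.presheaf.stalk x ≃ₗ[X.presheaf.stalk x] G.presheaf.stalk x,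
      ∀ (U : X.Opens) (hx : x ∈ U) (s : Γ(F, U)),
        e (F.presheaf.germ U x hx s) = G.presheaf.germ U x hx (φ.hom.app U s) := by
  have key {F G : X.Modules} (φ : F ⟶ G) :
    ∃ e : F.presheaf.stalk x →ₗ[X.presheaf.stalk x] G.presheaf.stalk x,
      ∀ (U : X.Opens) (hx : x ∈ U) (s : Γ(F, U)),
        e (F.presheaf.germ U x hx s) = G.presheaf.germ U x hx (φ.app U s) := by
    refine exists_linearMap_stalk F x (fun U hx => (G.presheaf.germ U x hx).hom.comp (φ.app U).hom)
      (fun U V hx i s => ?_) (fun U hx r s => ?_)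
    · have := congr($(φ.mapPresheaf.naturality i.op) s)
      have h2 := congr(G.presheaf.germ V x hx $this)
      erw [TopCat.Presheaf.germ_res_apply] at h2
      exact h2
    · refine (congrArg _ (φ.app_smul r s)).trans ?_
      exact germ_smul G hx r _
  obtain ⟨f, hf⟩ := key φ.hom
  obtain ⟨g, hg⟩ := key φ.inv
  refine ⟨LinearEquiv.ofLinearMap f g ?_ ?_, hf⟩
  · ext q
    obtain ⟨V, hV, q, rfl⟩ := TopCat.Presheaf.exists_germ_eq G.presheaf q
    simp only [LinearMap.comp_apply, LinearMap.id_apply, hg, hf]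
    refine congrArg _ ?_
    have := congr(Scheme.Modules.Hom.app $(φ.inv_hom_id) V q)
    exact this
  · ext q
    obtain ⟨V, hV, q, rfl⟩ := TopCat.Presheaf.exists_germ_eq F.presheaf q
    simp only [LinearMap.comp_apply, LinearMap.id_apply, hg, hf]
    refine congrArg _ ?_
    have := congr(Scheme.Modules.Hom.app $(φ.hom_inv_id) V q)
    exact this

lemma SatisfiesSerre.of_iso {F G : X.Modules} (φ : F ≅ G) {n : ℕ} (h : SatisfiesSerre n F) :
    SatisfiesSerre n G := fun x => by
  obtain ⟨e, -⟩ := exists_linearEquiv_stalk φ x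
  rw [← depth_eq_of_linearEquiv e]
  exact h x

lemma isFiniteType_of_iso {M N : SheafOfModules.{u} X.ringCatSheaf} (φ : M ≅ N)
    (h : M.IsFiniteType) : N.IsFiniteType := by
  obtain ⟨σ, hσ⟩ := h.exists_localGeneratorsData
  have (i : σ.I) : IsIso (SheafOfModules.Hom.over φ.hom (σ.X i)) :=
    inferInstanceAs (IsIso ((SheafOfModules.overFunctor X.ringCatSheaf (σ.X i)).map φ.hom))
  let τ : N.LocalGeneratorsData :=
    { I := σ.I
      X := σ.X
      coversTop := σ.coversTop
      generators i := (σ.generators i).ofEpi (SheafOfModules.Hom.over φ.hom (σ.X i)) }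
  have hτ : τ.IsFiniteType := by
    constructor
    intro i
    have := hσ.isFiniteType i
    exact inferInstanceAs ((σ.generators i).ofEpi _).IsFiniteType
  exact SheafOfModules.IsFiniteType.mk (M := N) ⟨τ, hτ⟩

lemma isFiniteType_of_generatingSections {M : SheafOfModules.{u} X.ringCatSheaf}
    (G : M.GeneratingSections) [G.IsFiniteType] : M.IsFiniteType := by
  have hG : G.localGeneratorsData.IsFiniteType := by
    constructor
    intro i
    exact ⟨inferInstanceAs (Finite G.I)⟩
  exact SheafOfModules.IsFiniteType.mk (M := M) ⟨_, hG⟩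

lemma IsCoherent.of_iso {F G : X.Modules} (φ : F ≅ G) (h : IsCoherent F) : IsCoherent G where
  isQuasicoherent := (SheafOfModules.isQuasicoherent X.ringCatSheaf).prop_of_iso φ h.1
  isFiniteType := isFiniteType_of_iso φ h.2

variable (X) in
/-- The structure sheaf as a module over itself. -/
def unitModule : X.Modules := SheafOfModules.unit X.ringCatSheaf

variable (X) in
lemma isCoherent_unitModule : IsCoherent (unitModule X) := by
  let M : SheafOfModules.{u} X.ringCatSheaf :=
    SheafOfModules.free.{u} (R := X.ringCatSheaf) PUnit.{u + 1}
  let G : M.GeneratingSections :=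
    SheafOfModules.free.generatingSections.{u} (R := X.ringCatSheaf) PUnit.{u + 1}
  have hG : G.IsFiniteType := ⟨inferInstanceAs (Finite PUnit.{u + 1})⟩
  have hF : IsCoherent (show X.Modules from M) :=
    { isQuasicoherent := by
        dsimp only [M]
        infer_instance
      isFiniteType := isFiniteType_of_generatingSections G }
  exact hF.of_iso (Limits.coproductUniqueIso fun _ : PUnit.{u + 1} => unitModule X)

/-- The numerator vanishes near `x` and the denominators are non-zero-divisors. This makes
evaluation at `x` injective on germs, so stalks may be computed inside `TotFrac X x`. -/
lemma exists_res_eq_zero {U : X.Opens} {s : Fam X U} (hs : s ∈ (totalQuotientSheaf X).obj U)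
    {x : X} (hx : x ∈ U) (h : s ⟨x, hx⟩ = 0) :
    ∃ (W : X.Opens) (hW : W ≤ U), x ∈ W ∧ Fam.res hW s = 0 := by
  obtain ⟨V, hV, hxV, a, b, hab⟩ := hs x hx
  have hax := (hab ⟨x, hxV⟩).2
  rw [h, mul_zero, eq_comm, map_eq_zero_iff _ (algebraMap_injective x)] at hax
  obtain ⟨W, hxW, i, j, hW⟩ := TopCat.Presheaf.germ_eq X.presheaf x hxV hxV a 0
    (by rw [hax, map_zero])
  refine ⟨W, i.le.trans hV, hxW, funext fun y => ?_⟩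
  obtain ⟨hb, h'⟩ := hab ⟨y.1, i.le y.2⟩
  have hay := congr(X.presheaf.germ W y.1 y.2 $hW)
  rw [map_zero, map_zero, TopCat.Presheaf.germ_res_apply] at hay
  rwa [hay, map_zero, (isUnit_algebraMap hb).mul_right_eq_zero] at h'

namespace Subsheaf

variable {I : Subsheaf X}

lemma apply_mem_stalk {U : X.Opens} {s : Fam X U} (hs : s ∈ I.obj U) {x : X} (hx : x ∈ U) :
    s ⟨x, hx⟩ ∈ I.stalk x := ⟨U, hx, s, hs, rfl⟩

/-- The stalk of the module attached to a subsheaf of `𝒦_X`. -/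
lemma exists_linearEquiv_toModules_stalk (hI : I ≤ totalQuotientSheaf X) (x : X) :
    ∃ e : I.toModules.presheaf.stalk x ≃ₗ[X.presheaf.stalk x] I.stalk x,
      ∀ (U : X.Opens) (hx : x ∈ U) (s : I.obj U),
        (e (I.toModules.presheaf.germ U x hx s) : TotFrac X x) = s.1 ⟨x, hx⟩ := by
  let f (U : X.Opens) (hx : x ∈ U) : Γ(I.toModules, U) →+ I.stalk x :=
    { toFun := fun s : I.obj U => ⟨s.1 ⟨x, hx⟩, apply_mem_stalk s.2 hx⟩
      map_zero' := rfl
      map_add' := fun _ _ => rfl }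
  obtain ⟨l, hl⟩ := exists_linearMap_stalk I.toModules x f (fun _ _ _ _ _ => rfl)
    (fun U hx r s => Subtype.ext (by
      refine (Fam.smul_apply r (show I.obj U from s).1 ⟨x, hx⟩).trans ?_
      exact (Algebra.smul_def _ _).symm))
  refine ⟨LinearEquiv.ofBijective l ⟨?_, ?_⟩, fun U hx s => congrArg Subtype.val (hl U hx s)⟩
  · rw [injective_iff_map_eq_zero]
    intro q hq
    obtain ⟨U, hx, s, rfl⟩ := TopCat.Presheaf.exists_germ_eq I.toModules.presheaf q
    rw [hl] at hq
    obtain ⟨W, hW, hxW, h⟩ := exists_res_eq_zero (hI U (show I.obj U from s).2) hx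
      (congrArg Subtype.val hq)
    rw [← TopCat.Presheaf.germ_res_apply I.toModules.presheaf (homOfLE hW) x hxW s,
      show I.toModules.presheaf.map (homOfLE hW).op s = 0 from Subtype.ext h, map_zero]
  · rintro ⟨_, U, hx, s, hs, rfl⟩
    exact ⟨I.toModules.presheaf.germ U x hx (⟨s, hs⟩ : I.obj U), hl U hx _⟩

lemma depth_stalk (hI : I ≤ totalQuotientSheaf X) (x : X) :
    depth (X.presheaf.stalk x) (I.toModules.presheaf.stalk x) =
      depth (X.presheaf.stalk x) (I.stalk x) := by
  obtain ⟨e, -⟩ := exists_linearEquiv_toModules_stalk hI x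
  exact depth_eq_of_linearEquiv e

/-- A local section of `I` through the value at `y` extends, after multiplication by `r ^ n`, to a
section `t'` on an affine neighbourhood of `x`. Then `r ^ n • s - t'` vanishes at `y`, so some `u`
invertible at `y` kills it at `x`. -/
lemma exists_smul_apply_mem_stalk (hI : I ≤ totalQuotientSheaf X) [I.toModules.IsQuasicoherent]
    {U : X.Opens} {s : Fam X U} (hs : s ∈ (totalQuotientSheaf X).obj U) {x y : X} (hx : x ∈ U)
    (hyx : y ⤳ x) (hy : s ⟨y, hyx.mem_open U.2 hx⟩ ∈ I.stalk y) :
    ∃ u : X.presheaf.stalk x, u • s ⟨x, hx⟩ ∈ I.stalk x ∧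
      IsUnit (X.presheaf.stalkSpecializes hyx u) := by
  obtain ⟨W, hyW, t, ht, hty⟩ := hy
  obtain ⟨V, hV, hxV, hVU⟩ := exists_isAffineOpen_mem_le hx
  have hyV := hyx.mem_open V.2 hxV
  obtain ⟨r, hrW, hyr⟩ := hV.exists_basicOpen_le ⟨y, hyW⟩ hyV
  obtain ⟨n, t', ht'⟩ := exists_res_eq_pow_smul I.toModules hV r
    (⟨Fam.res hrW t, I.res_mem hrW ht⟩ : I.obj (X.basicOpen r))
  have h1 := congrFun (congrArg Subtype.val ht') ⟨y, hyr⟩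
  change (show I.obj V from t').1 ⟨y, hyV⟩ =
    ((X.presheaf.map (homOfLE (X.basicOpen_le r)).op r) ^ n • Fam.res hrW t) ⟨y, hyr⟩ at h1
  rw [← map_pow, Fam.smul_apply, TopCat.Presheaf.germ_res_apply] at h1
  change _ = _ * t ⟨y, hyW⟩ at h1
  rw [hty] at h1
  obtain ⟨u, hu, hu'⟩ := exists_smul_apply_eq_zero (sub_mem
    (Submodule.smul_mem _ (r ^ n) ((totalQuotientSheaf X).res_mem hVU hs))
    (hI V (show I.obj V from t').2)) hxV hyx (by
      rw [Pi.sub_apply, Fam.smul_apply, h1]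
      exact sub_self _)
  refine ⟨u * X.presheaf.germ V x hxV (r ^ n), ?_, ?_⟩
  · rw [Pi.sub_apply, smul_sub, sub_eq_zero, Fam.smul_apply, ← Algebra.smul_def] at hu
    rw [mul_smul]
    refine (congrArg (· ∈ I.stalk x) hu).mpr ?_
    exact Submodule.smul_mem _ _ (apply_mem_stalk (show I.obj V from t').2 hxV)
  · rw [map_mul, TopCat.Presheaf.germ_stalkSpecializes_apply, map_pow]
    exact hu'.mul (((Scheme.mem_basicOpen _ _ _ _).mp hyr).pow n)

lemma mem_of_apply_mem_stalk (hI : I ≤ totalQuotientSheaf X) {U : X.Opens} {s : Fam X U}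
    (hs : s ∈ (totalQuotientSheaf X).obj U) (h : ∀ x (hx : x ∈ U), s ⟨x, hx⟩ ∈ I.stalk x) :
    s ∈ I.obj U := by
  refine I.glue s fun x hx => ?_
  obtain ⟨V, hxV, t, ht, htx⟩ := h x hx
  obtain ⟨W, hW, hxW, hW'⟩ := exists_res_eq_zero (U := V ⊓ U)
    (sub_mem ((totalQuotientSheaf X).res_mem inf_le_left (hI V ht))
      ((totalQuotientSheaf X).res_mem inf_le_right hs)) ⟨hxV, hx⟩ (sub_eq_zero.mpr htx)
  refine ⟨W, hW.trans inf_le_right, hxW, ?_⟩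
  have : Fam.res (hW.trans inf_le_right) s = Fam.res (hW.trans inf_le_left) t :=
    (sub_eq_zero.mp hW').symm
  rw [this]
  exact I.res_mem _ ht

/-- A quasi-coherent subsheaf of `𝒦_X` that satisfies `S_2` is equal to its `S_2`-ification. -/
theorem mem_of_apply_mem_stalk_of_ringKrullDim_le_one [IsLocallyNoetherian X]
    (hX : SchemeSatisfiesSerre 2 X)
    (hI : I ≤ totalQuotientSheaf X) [I.toModules.IsQuasicoherent]
    (hS : SatisfiesSerre 2 I.toModules) {U : X.Opens} {s : Fam X U}
    (hs : s ∈ (totalQuotientSheaf X).obj U)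
    (h : ∀ x (hx : x ∈ U), ringKrullDim (X.presheaf.stalk x) ≤ 1 → s ⟨x, hx⟩ ∈ I.stalk x) :
    s ∈ I.obj U := by
  refine mem_of_apply_mem_stalk hI hs ?_
  -- The conductor of `s` into `I`: the scalars moving `s` into the stalk.
  let J : ∀ x : X, Ideal (X.presheaf.stalk x) := fun x => ⨅ hx : x ∈ U,
    (I.stalk x).comap (LinearMap.toSpanSingleton (X.presheaf.stalk x) _ (s ⟨x, hx⟩))
  have mem_J (x : X) (hx : x ∈ U) (u) : u ∈ J x ↔ u • s ⟨x, hx⟩ ∈ I.stalk x := by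
    simp [J, hx]
  have J_eq_top (x : X) (hx : x ∈ U) : J x = ⊤ ↔ s ⟨x, hx⟩ ∈ I.stalk x := by
    rw [Ideal.eq_top_iff_one, mem_J x hx, one_smul]
  refine fun x hx => (J_eq_top x hx).mp (ideal_eq_top_of_generization U J ?_ ?_ x hx)
  · intro x y hx hyx hy
    obtain ⟨u, hu, hu'⟩ := exists_smul_apply_mem_stalk hI hs hx hyx ((J_eq_top y _).mp hy)
    exact ⟨u, (mem_J x hx u).mpr hu, hu'⟩
  intro x hx hm
  rw [J_eq_top x hx]
  by_cases hdim : ringKrullDim (X.presheaf.stalk x) ≤ 1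
  · exact h x hx hdim
  have hS' := hS x
  rw [depth_stalk hI] at hS'
  obtain ⟨a, ha, b, hb, hreg, hpair⟩ := exists_regular_pair_of_two_le_depth (two_le_depth hS' hdim)
  -- `a` is regular only on the stalk of `I`, perhaps not on `TotFrac X x`. The element `c`, regular
  -- on the local ring, becomes a unit there and will allow cancellation.
  obtain ⟨c, hc, hcreg⟩ := exists_isSMulRegular_of_one_le_depth
    (one_le_two.trans (two_le_depth (hX x) hdim))
  have hpow {a : X.presheaf.stalk x} (ha : a ∈ IsLocalRing.maximalIdeal (X.presheaf.stalk x)) :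
      ∃ n : ℕ, a ^ n • s ⟨x, hx⟩ ∈ I.stalk x := by
    obtain ⟨n, hn⟩ := hm ha
    exact ⟨n, (mem_J x hx _).mp hn⟩
  obtain ⟨k, hk⟩ := hpow ha
  obtain ⟨l, hl⟩ := hpow hb
  obtain ⟨m, hm⟩ := hpow hc
  -- From `b ^ l • (a ^ k • s) = a ^ k • (b ^ l • s)` inside `I`, the regular pair gives `a ^ k • s
  -- = a ^ k • t` with `t` in `I`.
  obtain ⟨⟨t, ht⟩, htk⟩ := exists_eq_pow_smul hreg hpair l k ⟨_, hk⟩ ⟨_, hl⟩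
    (Subtype.ext (smul_comm _ _ _))
  replace htk : a ^ k • s ⟨x, hx⟩ = a ^ k • t := congrArg Subtype.val htk
  have h0 : c ^ m • (s ⟨x, hx⟩ - t) = 0 := by
    have hmem : c ^ m • (s ⟨x, hx⟩ - t) ∈ I.stalk x := by
      rw [smul_sub]
      exact sub_mem hm (Submodule.smul_mem _ _ ht)
    have : (⟨_, hmem⟩ : I.stalk x) = 0 := (hreg.pow k).right_eq_zero_of_smul (Subtype.ext (by
      change a ^ k • c ^ m • (s ⟨x, hx⟩ - t) = 0
      rw [smul_comm, smul_sub, htk, sub_self, smul_zero]))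
    exact congrArg Subtype.val this
  have hcu : IsUnit (algebraMap (X.presheaf.stalk x) (TotFrac X x) (c ^ m)) :=
    isUnit_algebraMap (pow_mem (mem_nonZeroDivisors_iff_right.mpr
      fun z hz => hcreg.right_eq_zero_of_smul ((mul_comm c z).trans hz)) m)
  rw [Algebra.smul_def, hcu.mul_right_eq_zero, sub_eq_zero] at h0
  rwa [h0]

end Subsheaf

end Stalks

/-! ### Isomorphisms of modules from maps on sections. -/

section Image

variable {X : Scheme.{u}}

/-- A family of linear equivalences between sections that is compatible with restrictions induces
an isomorphism of modules. -/
lemma exists_iso_of_linearEquiv {F G : X.Modules} (e : ∀ U : X.Opens, Γ(F, U) ≃ₗ[Γ(X, U)] Γ(G, U))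
    (he : ∀ (U V : X.Opens) (i : V ⟶ U) (s : Γ(F, U)),
      e V (F.presheaf.map i.op s) = G.presheaf.map i.op (e U s)) :
    ∃ φ : F ≅ G, ∀ (U : X.Opens) (s : Γ(F, U)), φ.hom.app U s = e U s := by
  let ψ : F.presheaf ⟶ G.presheaf :=
    { app U := AddCommGrpCat.ofHom (e U.unop).toAddEquiv.toAddMonoidHom
      naturality U V i := by
        ext s
        exact he U.unop V.unop i.unop s }
  let φ : F ⟶ G := ⟨PresheafOfModules.homMk ψ fun U r m => (e U.unop).map_smul r m⟩
  have : IsIso φ := Scheme.Modules.Hom.isIso_iff_isIso_app.mpr fun U => by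
    rw [ConcreteCategory.isIso_iff_bijective]
    exact (e U).bijective
  exact ⟨asIso φ, fun _ _ => rfl⟩

/-- The image of an injective morphism to the sheaf of families. -/
def imageSubsheaf (F : X.Modules) (Φ : ∀ U : X.Opens, Γ(F, U) →ₗ[Γ(X, U)] Fam X U)
    (hres : ∀ (U V : X.Opens) (h : V ≤ U) (s : Γ(F, U)),
      Φ V (F.presheaf.map (homOfLE h).op s) = Fam.res h (Φ U s))
    (hinj : ∀ U, Function.Injective (Φ U)) : Subsheaf X where
  obj U := LinearMap.range (Φ U)
  res_mem := by
    rintro U V h _ ⟨s, rfl⟩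
    exact ⟨_, hres U V h s⟩
  glue := by
    intro U s hs
    choose V hV hx t ht using fun x : U => hs x.1 x.2
    obtain ⟨r, hr, -⟩ := TopCat.Sheaf.existsUnique_gluing' ⟨F.presheaf, F.isSheaf⟩ V U
      (fun x => homOfLE (hV x)) (fun x hx' => Opens.mem_iSup.mpr ⟨⟨x, hx'⟩, hx ⟨x, hx'⟩⟩) t
      (fun i j => hinj _ (by
        refine (hres _ _ inf_le_left _).trans (Eq.trans ?_ (hres _ _ inf_le_right _).symm)
        rw [ht, ht]
        rfl))
    refine ⟨r, funext fun x => ?_⟩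
    have h1 := (hres _ _ (hV x) r).symm.trans ((congrArg (Φ (V x)) (hr x)).trans (ht x))
    exact congrFun h1 ⟨x.1, hx x⟩

lemma exists_iso_imageSubsheaf (F : X.Modules) (Φ : ∀ U : X.Opens, Γ(F, U) →ₗ[Γ(X, U)] Fam X U)
    (hres : ∀ (U V : X.Opens) (h : V ≤ U) (s : Γ(F, U)),
      Φ V (F.presheaf.map (homOfLE h).op s) = Fam.res h (Φ U s))
    (hinj : ∀ U, Function.Injective (Φ U)) :
    Nonempty (F ≅ (imageSubsheaf F Φ hres hinj).toModules) := by
  obtain ⟨φ, -⟩ := exists_iso_of_linearEquiv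
    (G := (imageSubsheaf F Φ hres hinj).toModules)
    (fun U => LinearEquiv.ofInjective (Φ U) (hinj U))
    (fun U V i s => Subtype.ext (hres U V i.le s))
  exact ⟨φ⟩

lemma exists_iso_of_mul {I J : Subsheaf X} {f g : Fam X ⊤} (hfg : f * g = 1)
    (hf : ∀ U, ∀ s ∈ I.obj U, Fam.res le_top f * s ∈ J.obj U)
    (hg : ∀ U, ∀ s ∈ J.obj U, Fam.res le_top g * s ∈ I.obj U) :
    Nonempty (I.toModules ≅ J.toModules) := by
  have h (U : X.Opens) : (Fam.res le_top f * Fam.res le_top g : Fam X U) = 1 :=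
    funext fun x => congrFun hfg ⟨x.1, trivial⟩
  let e (U : X.Opens) : I.obj U ≃ₗ[Γ(X, U)] J.obj U :=
    { toFun s := ⟨_, hf U s.1 s.2⟩
      invFun s := ⟨_, hg U s.1 s.2⟩
      map_add' s t := Subtype.ext (mul_add _ _ _)
      map_smul' r s := Subtype.ext (mul_smul_comm _ _ _)
      left_inv s := Subtype.ext (by
        change Fam.res le_top g * (Fam.res le_top f * s.1) = s.1
        rw [← mul_assoc, mul_comm (Fam.res _ g), h, one_mul])
      right_inv s := Subtype.ext (by
        change Fam.res le_top f * (Fam.res le_top g * s.1) = s.1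
        rw [← mul_assoc, h, one_mul]) }
  obtain ⟨φ, -⟩ := exists_iso_of_linearEquiv (F := I.toModules) (G := J.toModules) e
    (fun _ _ _ _ => rfl)
  exact ⟨φ⟩

end Image

/-! ### Generic stalks, and isomorphisms as multiplications. -/

section GenericStalks

variable {X : Scheme.{u}} {I J : Subsheaf X}

lemma stalk_eq_top_of_isUnit [IsLocallyNoetherian X] {η : X} (hη : η ∈ genericPoints X)
    {q : TotFrac X η} (hq : IsUnit q) (h : q ∈ I.stalk η) : I.stalk η = ⊤ := by
  obtain ⟨q, rfl⟩ := hq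
  refine eq_top_iff.mpr fun r _ => ?_
  obtain ⟨c, hc⟩ := (algebraMap_bijective hη).2 (r * ↑q⁻¹)
  have := Submodule.smul_mem _ c h
  rwa [Algebra.smul_def, hc, Units.inv_mul_cancel_right] at this

lemma totalQuotientSheaf_stalk [IsLocallyNoetherian X] {η : X} (hη : η ∈ genericPoints X) :
    (totalQuotientSheaf X).stalk η = ⊤ :=
  stalk_eq_top_of_isUnit hη isUnit_one
    ⟨⊤, trivial, 1, one_mem_totalQuotientSheaf ⊤, rfl⟩

lemma IsNondegenerate.stalk_eq_top [IsLocallyNoetherian X] (hI : IsNondegenerate I) {η : X}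
    (hη : η ∈ genericPoints X) : I.stalk η = ⊤ :=
  (hI η hη).trans (totalQuotientSheaf_stalk hη)

lemma isNondegenerate_of_isUnit [IsLocallyNoetherian X]
    (h : ∀ η ∈ genericPoints X, ∃ q ∈ I.stalk η, IsUnit q) : IsNondegenerate I := fun η hη => by
  obtain ⟨q, hq, hu⟩ := h η hη
  rw [stalk_eq_top_of_isUnit hη hu hq, totalQuotientSheaf_stalk hη]

/-- Prescribe the inverses at the generic points; the product is then generically `1`, hence `1`. -/
lemma exists_mul_eq_one [IsNoetherian X] (hX : SchemeSatisfiesSerre 2 X) {f : Fam X ⊤}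
    (hf : f ∈ (totalQuotientSheaf X).obj ⊤)
    (hu : ∀ η ∈ genericPoints X, IsUnit (f ⟨η, trivial⟩)) :
    ∃ g ∈ (totalQuotientSheaf X).obj ⊤, f * g = 1 := by
  obtain ⟨g, hg, hgf⟩ := exists_section_of_genericPoints hX ⊤
    fun η => Ring.inverse (f ⟨η, trivial⟩)
  refine ⟨g, hg, ext_of_genericPoints hX (mul_mem_totalQuotientSheaf hf hg)
    (one_mem_totalQuotientSheaf ⊤) fun η hη hη' => ?_⟩
  rw [Pi.mul_apply, hgf η hη hη']
  exact Ring.mul_inverse_cancel _ (hu η hη)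

/-- An isomorphism between nondegenerate subsheaves of `𝒦_X` is the multiplication by a global
section of `𝒦_X`. -/
lemma exists_app_eq_mul [IsNoetherian X] (hX : SchemeSatisfiesSerre 2 X)
    (hI : I ≤ totalQuotientSheaf X) (hI' : IsNondegenerate I) (hJ : J ≤ totalQuotientSheaf X)
    (φ : I.toModules ≅ J.toModules) :
    ∃ f ∈ (totalQuotientSheaf X).obj ⊤, ∀ (U : X.Opens) (s : I.obj U),
      (show J.obj U from φ.hom.app U s).1 = Fam.res le_top f * s.1 := by
  have key (η : X) : ∃ q : TotFrac X η, η ∈ genericPoints X → ∀ (U : X.Opens) (hη : η ∈ U)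
      (s : I.obj U), (show J.obj U from φ.hom.app U s).1 ⟨η, hη⟩ = q * s.1 ⟨η, hη⟩ := by
    by_cases hη : η ∈ genericPoints X
    swap
    · exact ⟨0, fun h => absurd h hη⟩
    obtain ⟨a, ha⟩ := Subsheaf.exists_linearEquiv_toModules_stalk hI η
    obtain ⟨b, hb⟩ := Subsheaf.exists_linearEquiv_toModules_stalk hJ η
    obtain ⟨e, he⟩ := exists_linearEquiv_stalk φ η
    let l : I.stalk η →ₗ[X.presheaf.stalk η] TotFrac X η :=
      (J.stalk η).subtype.comp (a.symm.trans (e.trans b)).toLinearMap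
    -- The multiplier at `η` is the image of `1`, and every element of the stalk is an
    -- `𝒪_{X,η}`-multiple of `1`.
    have h1 : (1 : TotFrac X η) ∈ I.stalk η := by
      rw [hI'.stalk_eq_top hη]
      trivial
    refine ⟨l ⟨1, h1⟩, fun _ U hηU s => ?_⟩
    obtain ⟨c, hc⟩ := (algebraMap_bijective hη).2 (s.1 ⟨η, hηU⟩)
    have hs : (⟨s.1 ⟨η, hηU⟩, Subsheaf.apply_mem_stalk s.2 hηU⟩ : I.stalk η) = c • ⟨1, h1⟩ :=
      Subtype.ext (by
        refine hc.symm.trans ?_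
        change _ = c • (1 : TotFrac X η)
        rw [Algebra.smul_def, mul_one])
    have hls : l ⟨s.1 ⟨η, hηU⟩, Subsheaf.apply_mem_stalk s.2 hηU⟩ =
        (show J.obj U from φ.hom.app U s).1 ⟨η, hηU⟩ := by
      rw [← hb U hηU, ← he U hηU s]
      change (b (e (a.symm _)) : TotFrac X η) = _
      rw [a.symm_apply_eq.mpr (Subtype.ext (ha U hηU s).symm)]
    rw [← hls, hs, map_smul, Algebra.smul_def, hc, mul_comm]
  choose q hq using key
  obtain ⟨f, hf, hfq⟩ := exists_section_of_genericPoints hX ⊤ q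
  refine ⟨f, hf, fun U s => ext_of_genericPoints hX (hJ U (show J.obj U from φ.hom.app U s).2)
    (mul_mem_totalQuotientSheaf ((totalQuotientSheaf X).res_mem le_top hf) (hI U s.2))
    fun η hη hηU => ?_⟩
  rw [hq η hη U hηU s, Pi.mul_apply, ← hfq η hη trivial]
  rfl

end GenericStalks

/-! ### Principal divisors and linear equivalence. -/

section Principal

variable {X : Scheme.{u}}

lemma stalk_sectionsIn_le (N : ∀ x : X, Submodule (X.presheaf.stalk x) (TotFrac X x)) (x : X) :
    (sectionsIn N).stalk x ≤ N x := by
  rintro _ ⟨U, hx, s, hs, rfl⟩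
  exact hs.2 ⟨x, hx⟩

lemma mem_principalIdeal {f : Fam X ⊤} (hf : f ∈ (totalQuotientSheaf X).obj ⊤) :
    f ∈ (principalIdeal f).obj ⊤ :=
  ⟨hf, fun _ => Submodule.mem_span_singleton_self _⟩

/-- The ideal `(f)` of an invertible `f` is free of rank one. -/
lemma exists_iso_principalIdeal {f g : Fam X ⊤} (hf : f ∈ (totalQuotientSheaf X).obj ⊤)
    (hfg : f * g = 1) : Nonempty (unitModule X ≅ (principalIdeal f).toModules) := by
  let Φ (U : X.Opens) : Γ(X, U) →ₗ[Γ(X, U)] Fam X U :=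
    LinearMap.toSpanSingleton _ _ (Fam.res le_top f)
  have hΦ (U : X.Opens) (r : Γ(X, U)) (x : U) : Φ U r x =
      algebraMap _ (TotFrac X x.1) (X.presheaf.germ U x.1 x.2 r) * f ⟨x.1, trivial⟩ :=
    Fam.smul_apply _ _ _
  have hu (x : X) : IsUnit (f ⟨x, trivial⟩) :=
    .of_mul_eq_one (g ⟨x, trivial⟩) (congrFun hfg ⟨x, trivial⟩)
  have hres (U V : X.Opens) (h : V ≤ U) (r : Γ(X, U)) :
      Φ V (X.presheaf.map (homOfLE h).op r) = Fam.res h (Φ U r) :=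
    (Fam.res_smul h r (Fam.res le_top f)).symm
  have hinj (U : X.Opens) : Function.Injective (Φ U) := fun r s h =>
    TopCat.Presheaf.section_ext X.sheaf U r s fun x hx => by
      have := congrFun h ⟨x, hx⟩
      rw [hΦ, hΦ, (hu x).mul_left_inj] at this
      exact algebraMap_injective x this
  obtain ⟨φ⟩ := exists_iso_imageSubsheaf (unitModule X) Φ hres hinj
  let I := imageSubsheaf (unitModule X) Φ hres hinj
  have hI : I ≤ totalQuotientSheaf X := by
    rintro U _ ⟨r, rfl⟩
    exact Submodule.smul_mem _ _ ((totalQuotientSheaf X).res_mem le_top hf)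
  have : I = principalIdeal f := by
    refine Subsheaf.ext (funext fun U => Submodule.ext fun s => ⟨?_, fun hs => ?_⟩)
    · rintro ⟨r, rfl⟩
      exact Submodule.smul_mem _ _ ((principalIdeal f).res_mem le_top (mem_principalIdeal hf))
    · refine Subsheaf.mem_of_apply_mem_stalk hI hs.1 fun x hx => ?_
      refine (Submodule.span_singleton_le_iff_mem _ _).mpr ?_ (hs.2 ⟨x, hx⟩)
      exact Subsheaf.apply_mem_stalk (I := I) (U := ⊤) ⟨(1 : Γ(X, ⊤)), one_smul _ _⟩ trivial
  rw [← this]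
  exact ⟨φ⟩

lemma satisfiesSerre_unitModule {n : ℕ} (hX : SchemeSatisfiesSerre n X) :
    SatisfiesSerre n (unitModule X) := fun x => by
  obtain ⟨l, hl⟩ := exists_linearMap_stalk (unitModule X) x
    (fun U hx => (X.presheaf.germ U x hx).hom.toAddMonoidHom)
    (fun U V hx i s => TopCat.Presheaf.germ_res_apply X.presheaf i x hx s)
    (fun U hx r s => map_mul (X.presheaf.germ U x hx).hom r s)
  have hbij : Function.Bijective l := by
    refine ⟨(injective_iff_map_eq_zero l).mpr fun q hq => ?_, fun c => ?_⟩
    · obtain ⟨U, hx, s, rfl⟩ := TopCat.Presheaf.exists_germ_eq (unitModule X).presheaf q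
      obtain ⟨W, hxW, i, j, hW⟩ := TopCat.Presheaf.germ_eq X.presheaf x hx hx s (0 : Γ(X, U))
        (((hl U hx s).symm.trans hq).trans (map_zero _).symm)
      rw [← TopCat.Presheaf.germ_res_apply (unitModule X).presheaf i x hxW s,
        show (unitModule X).presheaf.map i.op s = 0 from hW.trans (map_zero _), map_zero]
    · obtain ⟨U, hx, s, rfl⟩ := TopCat.Presheaf.exists_germ_eq X.presheaf c
      exact ⟨_, hl U hx s⟩
  rw [depth_eq_of_linearEquiv (LinearEquiv.ofBijective l hbij)]
  exact hX x

/-- The principal divisor of an invertible section of `𝒦_X`. -/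
lemma exists_generalizedDivisor_principalIdeal [IsLocallyNoetherian X]
    (hX : SchemeSatisfiesSerre 2 X) {f g : Fam X ⊤} (hf : f ∈ (totalQuotientSheaf X).obj ⊤)
    (hfg : f * g = 1) : ∃ P : GeneralizedDivisor X, P.ideal = principalIdeal f := by
  obtain ⟨φ⟩ := exists_iso_principalIdeal hf hfg
  exact ⟨{ ideal := principalIdeal f
           isFractionalIdeal := ⟨fun _ _ hs => hs.1, (isCoherent_unitModule X).of_iso φ⟩
           nondegenerate := isNondegenerate_of_isUnit fun η hη =>
             ⟨f ⟨η, trivial⟩, Subsheaf.apply_mem_stalk (mem_principalIdeal hf) trivial,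
               .of_mul_eq_one (g ⟨η, trivial⟩) (congrFun hfg ⟨η, trivial⟩)⟩
           serre := (satisfiesSerre_unitModule hX).of_iso φ }, rfl⟩

/-- The ideal of the sum of `D` and the principal divisor `(f)` is `f · I_D`. -/
lemma GeneralizedDivisor.mem_s2ification_mulIdeal_iff [IsLocallyNoetherian X]
    (hX : SchemeSatisfiesSerre 2 X) (D : GeneralizedDivisor X) {f g : Fam X ⊤}
    (hf : f ∈ (totalQuotientSheaf X).obj ⊤) (hg : g ∈ (totalQuotientSheaf X).obj ⊤)
    (hfg : f * g = 1) {U : X.Opens} {t : Fam X U} :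
    t ∈ (s2ification (mulIdeal D.ideal (principalIdeal f))).obj U ↔
      Fam.res le_top g * t ∈ D.ideal.obj U := by
  have hx (x : X) : f ⟨x, trivial⟩ * g ⟨x, trivial⟩ = 1 := congrFun hfg ⟨x, trivial⟩
  have hK := D.isFractionalIdeal.le
  constructor
  · rintro ⟨ht, h⟩
    have := D.isFractionalIdeal.coherent.isQuasicoherent
    -- Saturation of `I_D` reduces the claim to codimension at most one, where the `S_2`-ification
    -- imposes membership in the product.
    refine Subsheaf.mem_of_apply_mem_stalk_of_ringKrullDim_le_one hX hK D.serre
      (mul_mem_totalQuotientSheaf ((totalQuotientSheaf X).res_mem le_top hg) ht) fun x hxU hdim => ?_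
    have h1 := mul_le_mul_right (stalk_sectionsIn_le _ x) _
      (stalk_sectionsIn_le _ x (h ⟨x, hxU⟩ hdim))
    obtain ⟨z, hz, hzt⟩ := Submodule.mem_mul_span_singleton.mp h1
    have : (Fam.res le_top g * t : Fam X U) ⟨x, hxU⟩ = z := by
      rw [Pi.mul_apply, ← hzt, mul_left_comm]
      change z * (g ⟨x, trivial⟩ * f ⟨x, trivial⟩) = z
      rw [mul_comm (g _), hx, mul_one]
    rwa [this]
  · intro h
    have hmem : t ∈ (mulIdeal D.ideal (principalIdeal f)).obj U := by
      have ht : t = (Fam.res le_top g * t) * Fam.res le_top f := funext fun x => by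
        change t x = g ⟨x.1, trivial⟩ * t x * f ⟨x.1, trivial⟩
        rw [mul_right_comm, mul_comm (g _), hx, one_mul]
      rw [ht]
      have hf' := (principalIdeal f).res_mem (le_top : U ≤ ⊤) (mem_principalIdeal hf)
      exact ⟨mul_mem_totalQuotientSheaf (hK U h) hf'.1, fun x => Submodule.mul_mem_mul
        (Subsheaf.apply_mem_stalk h x.2) (Subsheaf.apply_mem_stalk hf' x.2)⟩
    exact ⟨hmem.1, fun x _ => Subsheaf.apply_mem_stalk hmem x.2⟩

namespace GeneralizedDivisor

lemma IsSum.nonempty_iso [IsNoetherian X] (hX : SchemeSatisfiesSerre 2 X)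
    {D₁ D₂ P : GeneralizedDivisor X} (hP : P.IsPrincipal) (h : D₁.IsSum P D₂) :
    Nonempty (D₁.ideal.toModules ≅ D₂.ideal.toModules) := by
  obtain ⟨f, hf, hPf⟩ := hP
  -- Nondegeneracy of `P` puts `1` in the span of `f` at each generic point, so `f` is a unit there.
  obtain ⟨g, hg, hfg⟩ := exists_mul_eq_one hX hf fun η hη => by
    have h1 : (1 : TotFrac X η) ∈ P.ideal.stalk η := by
      rw [P.nondegenerate.stalk_eq_top hη]
      trivial
    rw [hPf] at h1
    obtain ⟨c, hc⟩ := Submodule.mem_span_singleton.mp (stalk_sectionsIn_le _ η h1)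
    rw [Algebra.smul_def, mul_comm] at hc
    exact .of_mul_eq_one _ hc
  have h' : D₂.ideal = s2ification (mulIdeal D₁.ideal (principalIdeal f)) := by
    rw [← hPf]
    exact h
  have mem_iff {U : X.Opens} {t : Fam X U} :
      t ∈ D₂.ideal.obj U ↔ Fam.res le_top g * t ∈ D₁.ideal.obj U := by
    rw [h', D₁.mem_s2ification_mulIdeal_iff hX hf hg hfg]
  refine exists_iso_of_mul hfg (fun U s hs => ?_) (fun U s hs => mem_iff.mp hs)
  rw [mem_iff, ← mul_assoc]
  have : (Fam.res le_top g * Fam.res le_top f : Fam X U) = 1 := funext fun x =>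
    (mul_comm _ _).trans (congrFun hfg ⟨x.1, trivial⟩)
  rwa [this, one_mul]

lemma exists_isSum_of_iso [IsNoetherian X] (hX : SchemeSatisfiesSerre 2 X)
    {D₁ D₂ : GeneralizedDivisor X} (φ : D₁.ideal.toModules ≅ D₂.ideal.toModules) :
    ∃ P : GeneralizedDivisor X, P.IsPrincipal ∧ D₁.IsSum P D₂ := by
  have h₁ := D₁.isFractionalIdeal.le
  have h₂ := D₂.isFractionalIdeal.le
  obtain ⟨f, hf, hφ⟩ := exists_app_eq_mul hX h₁ D₁.nondegenerate h₂ φ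
  obtain ⟨g, hg, hφ'⟩ := exists_app_eq_mul hX h₂ D₂.nondegenerate h₁ φ.symm
  have hgf (U : X.Opens) (s : D₁.ideal.obj U) :
      Fam.res le_top g * (Fam.res le_top f * s.1) = s.1 := by
    rw [← hφ U s, ← hφ' U (show D₂.ideal.obj U from φ.hom.app U s)]
    exact congrArg Subtype.val (congr(Scheme.Modules.Hom.app $(φ.hom_inv_id) U s))
  -- Evaluate `hgf` at a generic point on a section of the first ideal whose value there is `1`.
  have hfg : f * g = 1 := ext_of_genericPoints hX (mul_mem_totalQuotientSheaf hf hg)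
    (one_mem_totalQuotientSheaf ⊤) fun η hη _ => by
      have h1 : (1 : TotFrac X η) ∈ D₁.ideal.stalk η := by
        rw [D₁.nondegenerate.stalk_eq_top hη]
        trivial
      obtain ⟨U, hηU, s, hs, hs1⟩ := h1
      have := congrFun (hgf U ⟨s, hs⟩) ⟨η, hηU⟩
      dsimp only [Pi.mul_apply] at this
      rw [hs1, mul_one, mul_comm] at this
      exact this
  obtain ⟨P, hP⟩ := exists_generalizedDivisor_principalIdeal hX hf hfg
  refine ⟨P, ⟨f, hf, hP⟩, ?_⟩
  rw [IsSum, hP]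
  refine Subsheaf.ext (funext fun U => Submodule.ext fun t => ?_)
  rw [D₁.mem_s2ification_mulIdeal_iff hX hf hg hfg]
  refine ⟨fun ht => ?_, fun ht => ?_⟩
  · rw [← hφ' U ⟨t, ht⟩]
    exact Subtype.prop _
  · have h := (show D₂.ideal.obj U from φ.hom.app U (⟨_, ht⟩ : D₁.ideal.obj U)).2
    rw [hφ U ⟨_, ht⟩, ← mul_assoc] at h
    have : (Fam.res le_top f * Fam.res le_top g : Fam X U) = 1 := funext fun x =>
      congrFun hfg ⟨x.1, trivial⟩
    rwa [this, one_mul] at h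

/-- Two divisors are linearly equivalent if and only if their ideals are isomorphic. -/
theorem linearlyEquivalent_iff [IsNoetherian X] (hX : SchemeSatisfiesSerre 2 X)
    (D₁ D₂ : GeneralizedDivisor X) :
    D₁.LinearlyEquivalent D₂ ↔ Nonempty (D₁.ideal.toModules ≅ D₂.ideal.toModules) := by
  constructor
  · rintro ⟨P, hP, h | h⟩
    · exact h.nonempty_iso hX hP
    · exact (h.nonempty_iso hX hP).map Iso.symm
  · rintro ⟨φ⟩
    obtain ⟨P, hP, h⟩ := exists_isSum_of_iso hX φ
    exact ⟨P, hP, .inl h⟩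

end GeneralizedDivisor

end Principal

/-! ### Realizing a module as the ideal of a divisor. -/

section Realization

variable {X : Scheme.{u}}

/-- A coherent module that satisfies `S_2` and is generically free of rank one is isomorphic to the
ideal of a generalized divisor. -/
theorem exists_generalizedDivisor_iso [IsNoetherian X] (hX : SchemeSatisfiesSerre 2 X)
    (F : X.Modules) (hF : IsCoherent F) (hS : SatisfiesSerre 2 F)
    (hrank : ∀ η ∈ genericPoints X, IsLocallyFreeOfRankOneAt F η) :
    ∃ D : GeneralizedDivisor X, Nonempty (F ≅ D.ideal.toModules) := by
  have := hF.isQuasicoherent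
  have hψ (η : X) : ∃ l : F.presheaf.stalk η →ₗ[X.presheaf.stalk η] X.presheaf.stalk η,
      η ∈ genericPoints X → Function.Bijective l := by
    by_cases hη : η ∈ genericPoints X
    · obtain ⟨e⟩ := hrank η hη
      exact ⟨e.toLinearMap, fun _ => e.bijective⟩
    · exact ⟨0, fun h => absurd h hη⟩
  choose ψ hψ using hψ
  -- The image of `s` is the unique section of `𝒦_X` with the trivialized germs of `s` as generic
  -- values; uniqueness yields linearity and compatibility with restriction.
  have hΦ (U : X.Opens) (s : Γ(F, U)) : ∃ t ∈ (totalQuotientSheaf X).obj U,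
      ∀ η ∈ genericPoints X, ∀ hη : η ∈ U,
        t ⟨η, hη⟩ = algebraMap _ (TotFrac X η) (ψ η (F.presheaf.germ U η hη s)) := by
    obtain ⟨t, ht, h⟩ := exists_section_of_genericPoints hX U fun η => by
      classical
      exact if hη : η ∈ U then algebraMap _ (TotFrac X η) (ψ η (F.presheaf.germ U η hη s)) else 0
    exact ⟨t, ht, fun η hη hηU => (h η hη hηU).trans (dif_pos hηU)⟩
  choose Φ hΦK hΦ using hΦ
  let Φ' (U : X.Opens) : Γ(F, U) →ₗ[Γ(X, U)] Fam X U :=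
    { toFun := Φ U
      map_add' s t := ext_of_genericPoints hX (hΦK U _) (add_mem (hΦK U s) (hΦK U t))
        fun η hη hηU => by
          rw [Pi.add_apply, hΦ U _ η hη, hΦ U _ η hη, hΦ U _ η hη, map_add, map_add, map_add]
      map_smul' r s := ext_of_genericPoints hX (hΦK U _) (Submodule.smul_mem _ _ (hΦK U s))
        fun η hη hηU => by
          rw [RingHom.id_apply, Fam.smul_apply, hΦ U _ η hη, hΦ U _ η hη, germ_smul, map_smul,
            smul_eq_mul, map_mul] }
  have hres (U V : X.Opens) (h : V ≤ U) (s : Γ(F, U)) :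
      Φ' V (F.presheaf.map (homOfLE h).op s) = Fam.res h (Φ' U s) :=
    ext_of_genericPoints hX (hΦK V _) ((totalQuotientSheaf X).res_mem h (hΦK U s))
      fun η hη hηV => by
        refine (hΦ V _ η hη hηV).trans (Eq.trans ?_ (hΦ U s η hη (h hηV)).symm)
        rw [TopCat.Presheaf.germ_res_apply]
  have hinj (U : X.Opens) : Function.Injective (Φ' U) := by
    rw [injective_iff_map_eq_zero]
    intro s hs
    refine eq_zero_of_germ_genericPoints_eq_zero hS s fun η hη hηU => ?_
    have h0 := (hΦ U s η hη hηU).symm.trans (congrFun hs ⟨η, hηU⟩)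
    rw [Pi.zero_apply, map_eq_zero_iff _ (algebraMap_injective η)] at h0
    exact (map_eq_zero_iff _ (hψ η hη).1).mp h0
  obtain ⟨φ⟩ := exists_iso_imageSubsheaf F Φ' hres hinj
  refine ⟨{ ideal := imageSubsheaf F Φ' hres hinj
            isFractionalIdeal := ⟨?_, hF.of_iso φ⟩
            nondegenerate := isNondegenerate_of_isUnit fun η hη => ⟨1, ?_, isUnit_one⟩
            serre := hS.of_iso φ }, ⟨φ⟩⟩
  · rintro U _ ⟨s, rfl⟩
    exact hΦK U s
  -- The germ that trivializes to `1` supplies a section of the image with value `1` at `η`.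
  · obtain ⟨q, hq⟩ := (hψ η hη).2 1
    obtain ⟨U, hηU, s, rfl⟩ := TopCat.Presheaf.exists_germ_eq F.presheaf q
    refine ⟨U, hηU, Φ' U s, ⟨s, rfl⟩, (hΦ U s η hη hηU).trans ?_⟩
    rw [hq, map_one]

end Realization

end GenDiv

end

theorem proposition2p4 (X : Scheme.{u}) [AlgebraicGeometry.IsNoetherian X]
    (hX : GenDiv.SchemeSatisfiesSerre 2 X) :
    (∀ D₁ D₂ : GenDiv.GeneralizedDivisor X,
      D₁.LinearlyEquivalent D₂ ↔ Nonempty (D₁.ideal.toModules ≅ D₂.ideal.toModules)) ∧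
    (∀ F : X.Modules, GenDiv.IsCoherent F → GenDiv.SatisfiesSerre 2 F →
      (∀ η ∈ genericPoints X, GenDiv.IsLocallyFreeOfRankOneAt F η) →
      ∃ D : GenDiv.GeneralizedDivisor X, Nonempty (F ≅ D.ideal.toModules)) :=
  ⟨GenDiv.GeneralizedDivisor.linearlyEquivalent_iff hX, GenDiv.exists_generalizedDivisor_iso hX⟩
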